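/- **Notation.** Let $E$ be an Archimedean (real) vector lattice with positive cone $E^+$, let $m\ge 1$, and let $h:\mathbb R^m\to\mathbb R$ be continuous and positively homogeneous, i.e. $h(\lambda x)=\lambda h(x)$ for all $\lambda\ge 0$ and $x\in\mathbb R^m$. For $a_1,\dots,a_m,b\in E$ we write $h(a_1,\dots,a_m)=b$ when $h(\omega(a_1),\dots,\omega(a_m))=\omega(b)$ for every nonzero vector lattice homomorphism $\omega:\langle a_1,\dots,a_m,b\rangle\to\mathbb R$, where $\langle a_1,\dots,a_m,b\rangle$ is the vector sublattice of $E$ generated by $a_1,\dots,a_m,b$. With $\|\cdot\|$ the Euclidean norm and $\mathbb R^+=[0,\infty)$, put $$\Delta_h=\{c\in(\mathbb R^+)^m:\ h \text{ is differentiable at } c \text{ and } \|c\|=1\},$$ where differentiability is that of $h$ as a function on $\mathbb R^m$. For $a=(a_1,\dots,a_m)\in E^m$ and $c\in\mathbb R^m$ at which the partial derivatives of $h$ exist, put $\nabla h(c)\cdot a=\sum_{k=1}^m\frac{\partial h(c)}{\partial x_k}a_k$. For $m\ge 2$ and $\theta=(\theta_1,\dots,\theta_{m-1})\in\mathbb R^{m-1}$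 let $s_\theta\in\mathbb R^m$ be the point with coordinates $$(s_\theta)_k=\Bigl(\prod_{j=1}^{k-1}\sin\theta_j\Bigr)\cos\theta_k\quad(1\le k\le m-1),\qquad (s_\theta)_m=\prod_{j=1}^{m-1}\sin\theta_j,$$ and for $n\in\mathbb N=\{1,2,\dots\}$ let $$P_n=\Bigl\{\Bigl(\tfrac{l_1\pi}{2^{n+1}},\dots,\tfrac{l_{m-1}\pi}{2^{n+1}}\Bigr):\ l_1,\dots,l_{m-1}\in\{1,\dots,2^n\}\Bigr\}.$$ A sequence $(f_n)$ in $E$ converges relatively uniformly to $f\in E$ if there is $p\in E$ with $p>0$ such that for every $\epsilon>0$ there is $N$ with $|f_n-f|<\epsilon p$ for all $n\ge N$ (where $x<y$ means $x\le y$ and $x\ne y$). **Theorem 3.8.** Let $E$, $m$ and $h$ be as above, and let $a=(a_1,\dots,a_m)$ with $a_1,\dots,a_m\in E^+$. (1) If $h$ is convex (respectively, concave) on $(\mathbb R^+)^m$, then for every $b\in E$: $h(a_1,\dots,a_m)=b$ if and only if $b$ is the supremum in $E$ of $\{\nabla h(c)\cdot a: c\in\Delta_h\}$ (respectively, the infimum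 in $E$ of this set). (2) Suppose that $E\ne\{0\}$, that $m\ge 2$, that $h$ is convex (respectively, concave) on $(\mathbb R^+)^m$, and that all partial derivatives of $h$ exist and are uniformly continuous on $\{s_\theta:\theta\in\bigcup_{n\in\mathbb N}P_n\}$. If $h(a_1,\dots,a_m)$ exists in $E$, that is, if $h(a_1,\dots,a_m)=b$ for some $b\in E$, then the sequence $\bigl(\sup\{\nabla h(s_\theta)\cdot a:\theta\in P_n\}\bigr)_{n}$ (respectively, $\bigl(\inf\{\nabla h(s_\theta)\cdot a:\theta\in P_n\}\bigr)_{n}$) converges relatively uniformly to $b$. -/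

import Mathlib

noncomputable section

namespace VL

/-- Archimedean property of an ordered real vector space: if `0 ≤ x` and all the multiples
`n • x` are below one fixed `y`, then `x = 0`. (Mathlib's class `Archimedean` is a different
notion when the order is not total.) -/
def IsArchimedean (E : Type*) [AddCommGroup E] [Lattice E] : Prop :=
  ∀ x y : E, 0 ≤ x → (∀ n : ℕ, n • x ≤ y) → x = 0

section Sublattice

variable {E : Type*} [AddCommGroup E] [Lattice E] [Module ℝ E]

/-- A linear subspace closed under finite suprema and infima. -/
def IsVectorSublattice (L : Submodule ℝ E) : Prop :=
  ∀ x ∈ L, ∀ y ∈ L, x ⊔ y ∈ L ∧ x ⊓ y ∈ L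

/-- The vector sublattice `⟨A⟩` generated by `A`. -/
def latticeSpan (A : Set E) : Submodule ℝ E :=
  sInf {L | IsVectorSublattice L ∧ A ⊆ L}

theorem subset_latticeSpan (A : Set E) : A ⊆ latticeSpan A := by
  intro x hx
  exact Submodule.mem_sInf.2 fun L hL => hL.2 hx

theorem isVectorSublattice_latticeSpan (A : Set E) : IsVectorSublattice (latticeSpan A) := by
  intro x hx y hy
  have hx' := Submodule.mem_sInf.1 hx
  have hy' := Submodule.mem_sInf.1 hy
  exact ⟨Submodule.mem_sInf.2 fun L hL => (hL.1 x (hx' L hL) y (hy' L hL)).1,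
    Submodule.mem_sInf.2 fun L hL => (hL.1 x (hx' L hL) y (hy' L hL)).2⟩

/-- `⟨A⟩` with the lattice operations of `E`. -/
instance instLatticeLatticeSpan (A : Set E) : Lattice (latticeSpan A) :=
  Subtype.lattice
    (fun {x y} hx hy => (isVectorSublattice_latticeSpan A x hx y hy).1)
    (fun {x y} hx hy => (isVectorSublattice_latticeSpan A x hx y hy).2)

end Sublattice

/-- The set `H(L)` of all nonzero real-valued vector lattice homomorphisms on `L`. -/
def realHoms (L : Type*) [AddCommGroup L] [Lattice L] [Module ℝ L] : Set (L →ₗ[ℝ] ℝ) :=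
  {ω | ω ≠ 0 ∧ ∀ x y : L, ω (x ⊔ y) = ω x ⊔ ω y ∧ ω (x ⊓ y) = ω x ⊓ ω y}

/-- The set `𝓗(ℝᵐ)` of continuous positively homogeneous functions `ℝᵐ → ℝ`. -/
def posHom (m : ℕ) : Set (EuclideanSpace ℝ (Fin m) → ℝ) :=
  {h | Continuous h ∧ ∀ t : ℝ, 0 ≤ t → ∀ x, h (t • x) = t * h x}

/-- The closed positive orthant `(ℝ⁺)ᵐ`. -/
def orthant (m : ℕ) : Set (EuclideanSpace ℝ (Fin m)) :=
  {x | ∀ k, 0 ≤ x k}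

section Calculus

variable {m : ℕ} {E : Type*} [AddCommGroup E] [Lattice E] [Module ℝ E]

/-- The relation `h(a₁, …, aₘ) = b` of the functional calculus on `E`: one has
`h(ω(a₁), …, ω(aₘ)) = ω(b)` for every `ω ∈ H(⟨a₁, …, aₘ, b⟩)`. -/
def CalcEq (h : EuclideanSpace ℝ (Fin m) → ℝ) (a : Fin m → E) (b : E) : Prop :=
  ∀ ω ∈ realHoms (latticeSpan (insert b (Set.range a))),
    h (WithLp.toLp 2 fun k =>
        ω ⟨a k, subset_latticeSpan _ (Set.mem_insert_of_mem b (Set.mem_range_self k))⟩)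
      = ω ⟨b, subset_latticeSpan _ (Set.mem_insert b (Set.range a))⟩

/-- The partial derivative `∂h/∂xₖ` at `c` (meaningful where `HasPartial h k c`). -/
def partialD (h : EuclideanSpace ℝ (Fin m) → ℝ) (k : Fin m) (c : EuclideanSpace ℝ (Fin m)) : ℝ :=
  lineDeriv ℝ h c (EuclideanSpace.single k 1)

/-- The partial derivative `∂h/∂xₖ` exists at `c`. -/
def HasPartial (h : EuclideanSpace ℝ (Fin m) → ℝ) (k : Fin m) (c : EuclideanSpace ℝ (Fin m)) :
    Prop :=
  LineDifferentiableAt ℝ h c (EuclideanSpace.single k 1)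

/-- `∇h(c) · a = ∑ₖ (∂h/∂xₖ)(c) aₖ`. -/
def gradDot (h : EuclideanSpace ℝ (Fin m) → ℝ) (c : EuclideanSpace ℝ (Fin m)) (a : Fin m → E) : E :=
  ∑ k, partialD h k c • a k

/-- `Δₕ`: the Euclidean unit vectors of the closed positive orthant at which `h` is
differentiable, as a function on all of `ℝᵐ`. -/
def diffUnit (h : EuclideanSpace ℝ (Fin m) → ℝ) : Set (EuclideanSpace ℝ (Fin m)) :=
  {c | c ∈ orthant m ∧ DifferentiableAt ℝ h c ∧ ‖c‖ = 1}

/-- The point `s_θ` with spherical coordinates `θ = (θ₁, …, θₘ₋₁)`: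
`(cos θ₁, sin θ₁ cos θ₂, …, sin θ₁ ⋯ sin θₘ₋₂ cos θₘ₋₁, sin θ₁ ⋯ sin θₘ₋₁)`. -/
def sph (θ : Fin (m - 1) → ℝ) : EuclideanSpace ℝ (Fin m) :=
  WithLp.toLp 2 fun k =>
    (∏ j : Fin (m - 1) with j.val < k.val, Real.sin (θ j)) *
      if hk : k.val < m - 1 then Real.cos (θ ⟨k.val, hk⟩) else 1

variable (m) in
/-- The grid `Pₙ` of angles `(l₁π/2ⁿ⁺¹, …, lₘ₋₁π/2ⁿ⁺¹)` with `l₁, …, lₘ₋₁ ∈ {1, …, 2ⁿ}`. -/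
def grid (n : ℕ) : Finset (Fin (m - 1) → ℝ) :=
  (Fintype.piFinset fun _ : Fin (m - 1) => Finset.Icc (1 : ℕ) (2 ^ n)).image
    fun (l : Fin (m - 1) → ℕ) j => (l j : ℝ) * Real.pi / 2 ^ (n + 1)

variable (m) in
theorem grid_nonempty (n : ℕ) : (grid m n).Nonempty :=
  (Fintype.piFinset_nonempty.2 fun _ => Finset.nonempty_Icc.2 Nat.one_le_two_pow).image _

variable (m) in
/-- The set of all `s_θ` with `θ` in some grid `Pₙ`, `n ≥ 1`. -/
def gridPoints : Set (EuclideanSpace ℝ (Fin m)) :=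
  {c | ∃ n : ℕ, 1 ≤ n ∧ ∃ θ ∈ grid m n, c = sph θ}

/-- All partial derivatives of `h` exist and are uniformly continuous on `gridPoints m`. -/
def UnifContPartials (h : EuclideanSpace ℝ (Fin m) → ℝ) : Prop :=
  ∀ k : Fin m, (∀ c ∈ gridPoints m, HasPartial h k c) ∧
    UniformContinuousOn (partialD h k) (gridPoints m)

/-- `sup {∇h(s_θ) · a : θ ∈ Pₙ}`, a finite supremum in `E`. -/
def gridSup (h : EuclideanSpace ℝ (Fin m) → ℝ) (a : Fin m → E) (n : ℕ) : E :=
  (grid m n).sup' (grid_nonempty m n) fun θ => gradDot h (sph θ) a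

/-- `inf {∇h(s_θ) · a : θ ∈ Pₙ}`, a finite infimum in `E`. -/
def gridInf (h : EuclideanSpace ℝ (Fin m) → ℝ) (a : Fin m → E) (n : ℕ) : E :=
  (grid m n).inf' (grid_nonempty m n) fun θ => gradDot h (sph θ) a

/-- Relatively uniform convergence of `f` to `g`. -/
def RUConverges (f : ℕ → E) (g : E) : Prop :=
  ∃ p : E, 0 < p ∧ ∀ ε : ℝ, 0 < ε → ∃ N : ℕ, ∀ n ≥ N, |f n - g| < ε • p

end Calculus

end VL

end

open Filter Topology

namespace VL

/-! Two facts carry the theorem. First, inequalities in `E` can be tested on real homomorphisms: a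
finitely generated sublattice of an Archimedean vector lattice has a strong unit, and there a prime
solid subspace, found by Zorn's lemma, yields a homomorphism detecting any element not below `0`
(`exists_realHom_pos`, `le_of_forall_isHomOn`).

Second, a convex positively homogeneous `h` is on the orthant the supremum of its linearizations `x
↦ ∇h(c) · x`: tangents at `c` lie below `h`, and homogeneity turns them into linear minorants that
touch `h` along the ray of `c`. If these rays are dense, compactness of the unit sphere gives
finitely many linearizations within `ε ∑ xₖ` of `h` (`approxBy_of_dense`). The property `ApproxBy`
records this. It holds for `diffUnit h` by Rademacher's theorem, and for the grid points by
spherical coordinates and continuity of the partial derivatives.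

Testing on homomorphisms carries the approximation over to `E`, with error `ε ∑ aₖ`
(`le_sup'_gradDot_add`). This finite estimate is what links suprema in `E` to homomorphisms, which
need not preserve infinite suprema; it also gives the relatively uniform convergence, because the
grids are nested. The concave case follows by replacing `h` and `b` by `-h` and `-b`. -/

theorem negPart_add_le {L : Type*} [AddCommGroup L] [Lattice L] [IsOrderedAddMonoid L] (v w : L) :
    (v + w)⁻ ≤ v⁻ + w⁻ := by
  refine sup_le ?_ (add_nonneg (negPart_nonneg v) (negPart_nonneg w))
  rw [neg_add]
  exact add_le_add (neg_le_negPart v) (neg_le_negPart w)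

theorem negPart_smul_le {L : Type*} [AddCommGroup L] [Lattice L] [Module ℝ L]
    [IsOrderedModule ℝ L] {t : ℝ} (ht : 0 ≤ t) (v : L) : (t • v)⁻ ≤ t • v⁻ := by
  refine sup_le ?_ (smul_nonneg ht (negPart_nonneg v))
  rw [← smul_neg]
  exact smul_le_smul_of_nonneg_left (neg_le_negPart v) ht

/-! ### Prime solid subspaces and the existence of real homomorphisms. -/

section Separation

variable {L : Type*} [AddCommGroup L] [Lattice L] [IsOrderedAddMonoid L] [Module ℝ L]
  [IsOrderedModule ℝ L]

open LatticeOrderedAddCommGroup (IsSolid)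

theorem abs_smul_le (t : ℝ) (v : L) : |t • v| ≤ |t| • |v| := by
  have key : ∀ (s : ℝ), s ≤ |t| → -s ≤ |t| → s • v ≤ |t| • |v| := by
    intro s h1 h2
    rcases le_total 0 s with hs | hs
    · exact (smul_le_smul_of_nonneg_left (le_abs_self v) hs).trans
        (smul_le_smul_of_nonneg_right h1 (abs_nonneg v))
    · have : s • v = (-s) • (-v) := by simp
      rw [this]
      exact (smul_le_smul_of_nonneg_left (neg_le_abs v) (by linarith)).trans
        (smul_le_smul_of_nonneg_right h2 (abs_nonneg v))
  refine sup_le (key t (le_abs_self t) (neg_le_abs t)) ?_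
  rw [← neg_smul]
  exact key (-t) (neg_le_abs t) (by simpa using le_abs_self t)

/-- The solid submodule generated by the solid submodule `P` and the positive element `x`. -/
def solidAdjoin (P : Submodule ℝ L) (x : L) : Submodule ℝ L where
  carrier := {v | ∃ p ∈ P, ∃ r : ℝ, 0 ≤ r ∧ |v| ≤ p + r • x}
  zero_mem' := ⟨0, P.zero_mem, 0, le_rfl, by simp⟩
  add_mem' := by
    rintro v w ⟨p, hp, r, hr, h1⟩ ⟨q, hq, s, hs, h2⟩
    refine ⟨p + q, P.add_mem hp hq, r + s, add_nonneg hr hs, ?_⟩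
    calc |v + w| ≤ |v| + |w| := abs_add_le v w
      _ ≤ (p + r • x) + (q + s • x) := add_le_add h1 h2
      _ = _ := by rw [add_smul]; abel
  smul_mem' := by
    rintro t v ⟨p, hp, r, hr, h1⟩
    refine ⟨|t| • p, P.smul_mem _ hp, |t| * r, by positivity, ?_⟩
    calc |t • v| ≤ |t| • |v| := abs_smul_le t v
      _ ≤ |t| • (p + r • x) := smul_le_smul_of_nonneg_left h1 (abs_nonneg t)
      _ = _ := by rw [smul_add, mul_smul]

theorem isSolid_solidAdjoin (P : Submodule ℝ L) (x : L) :
    IsSolid (solidAdjoin P x : Set L) := by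
  rintro v ⟨p, hp, r, hr, h⟩ w hw
  exact ⟨p, hp, r, hr, hw.trans h⟩

theorem le_solidAdjoin {P : Submodule ℝ L} (hP : IsSolid (P : Set L)) (x : L) :
    P ≤ solidAdjoin P x := fun v hv =>
  ⟨|v|, hP hv (by rw [abs_abs]), 0, le_rfl, by simp⟩

theorem mem_solidAdjoin_self (P : Submodule ℝ L) (x : L) (hx : 0 ≤ x) :
    x ∈ solidAdjoin P x :=
  ⟨0, P.zero_mem, 1, zero_le_one, by simp [abs_of_nonneg hx]⟩

/-- Take `P` maximal among the solid subspaces avoiding `z`. If `x` and `y` were both outside `P`,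
adjoining either one would capture `z`, so `|z|` would be bounded modulo `P` by multiples of `x` and
of `y`, hence by a multiple of `x ⊓ y = 0`, forcing `z ∈ P`. -/
theorem exists_prime_solid {z : L} (hz : z ≠ 0) :
    ∃ P : Submodule ℝ L, IsSolid (P : Set L) ∧ z ∉ P ∧ ∀ x y : L, x ⊓ y = 0 → x ∈ P ∨ y ∈ P := by
  have hbot : (⊥ : Submodule ℝ L) ∈ {P : Submodule ℝ L | IsSolid (P : Set L) ∧ z ∉ P} := by
    refine ⟨fun x hx y hy => ?_, by simpa using hz⟩
    have hx0 : x = 0 := by simpa using hx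
    rw [hx0, abs_zero] at hy
    have : y = 0 := le_antisymm ((le_abs_self y).trans hy)
      (neg_nonpos.1 ((neg_le_abs y).trans hy))
    simp [this]
  obtain ⟨P, -, hPmax⟩ := zorn_le_nonempty₀ {P : Submodule ℝ L | IsSolid (P : Set L) ∧ z ∉ P}
    (by
      intro c hc hchain Q hQ
      have hmem : ∀ v, v ∈ sSup c ↔ ∃ R ∈ c, v ∈ R := fun v =>
        Submodule.mem_sSup_of_directed ⟨Q, hQ⟩ hchain.directedOn
      refine ⟨sSup c, ⟨?_, ?_⟩, fun R hR => le_sSup hR⟩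
      · intro x hx y hy
        obtain ⟨R, hR, hxR⟩ := (hmem x).1 hx
        exact (hmem y).2 ⟨R, hR, (hc hR).1 hxR hy⟩
      · intro h
        obtain ⟨R, hR, hzR⟩ := (hmem z).1 h
        exact (hc hR).2 hzR) ⊥ hbot
  obtain ⟨hPs, hzP⟩ := hPmax.prop
  refine ⟨P, hPs, hzP, fun x y hxy => ?_⟩
  by_contra! hcon
  have hx : 0 ≤ x := hxy ▸ inf_le_left
  have hy : 0 ≤ y := hxy ▸ inf_le_right
  have hmem : ∀ w (hw : 0 ≤ w), w ∉ P → z ∈ solidAdjoin P w := by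
    intro w hw hwP
    by_contra hzw
    exact hwP (hPmax.le_of_ge ⟨isSolid_solidAdjoin P w, hzw⟩ (le_solidAdjoin hPs w)
      (mem_solidAdjoin_self P w hw))
  obtain ⟨p, hp, r, hr, h1⟩ := hmem x hx hcon.1
  obtain ⟨q, hq, s, hs, h2⟩ := hmem y hy hcon.2
  apply hzP
  -- `N` dominates both coefficients; the `1` makes it invertible.
  set N : ℝ := r + s + 1
  have hN : 0 < N := by positivity
  have hinf : (N • x) ⊓ (N • y) ≤ 0 := by
    have h3 : N⁻¹ • ((N • x) ⊓ (N • y)) ≤ x ⊓ y := by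
      refine le_inf ?_ ?_
      · calc _ ≤ N⁻¹ • (N • x) := smul_le_smul_of_nonneg_left inf_le_left (by positivity)
          _ = x := by rw [smul_smul, inv_mul_cancel₀ hN.ne', one_smul]
      · calc _ ≤ N⁻¹ • (N • y) := smul_le_smul_of_nonneg_left inf_le_right (by positivity)
          _ = y := by rw [smul_smul, inv_mul_cancel₀ hN.ne', one_smul]
    rw [hxy] at h3
    have h4 := smul_le_smul_of_nonneg_left h3 hN.le
    rwa [smul_smul, mul_inv_cancel₀ hN.ne', one_smul, smul_zero] at h4
  have h5 : |z| ≤ |p| + |q| := by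
    have ha : |z| ≤ N • x + (|p| + |q|) := by
      refine h1.trans ?_
      rw [add_comm]
      exact add_le_add (smul_le_smul_of_nonneg_right (by simp only [N]; linarith) hx)
        ((le_abs_self p).trans (le_add_of_nonneg_right (abs_nonneg q)))
    have hb : |z| ≤ N • y + (|p| + |q|) := by
      refine h2.trans ?_
      rw [add_comm]
      exact add_le_add (smul_le_smul_of_nonneg_right (by simp only [N]; linarith) hy)
        ((le_abs_self q).trans (le_add_of_nonneg_left (abs_nonneg p)))
    have hc := le_inf ha hb
    rw [← inf_add] at hc
    exact hc.trans (by simpa using add_le_add_left hinf (|p| + |q|))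
  have h6 : |p| + |q| ∈ P :=
    P.add_mem (hPs hp (by rw [abs_abs])) (hPs hq (by rw [abs_abs]))
  exact hPs h6 (h5.trans (le_abs_self _))

/-- In an Archimedean vector lattice with strong unit `e`, real-valued lattice homomorphisms
detect the elements that are not below `0`. -/
theorem exists_realHom_pos (hL : IsArchimedean L) {e : L} (he : 0 ≤ e)
    (hunit : ∀ v : L, ∃ n : ℕ, v ≤ n • e) {y : L} (hy : ¬ y ≤ 0) :
    ∃ ω ∈ realHoms L, 0 < ω y := by
  -- The Archimedean property enters here. A prime `P` that misses `(n • y - e)⁺` will force `ω e ≤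
  -- n * ω y`, and so `0 < ω y`.
  obtain ⟨n, hn⟩ : ∃ n : ℕ, ¬ n • y⁺ ≤ e := by
    by_contra! hcon
    exact hy (posPart_eq_zero.1 (hL y⁺ e (posPart_nonneg y) hcon))
  have hz : (n • y - e)⁺ ≠ 0 := by
    intro h0
    apply hn
    have h1 : (n : ℝ) • y ≤ e := by
      rw [Nat.cast_smul_eq_nsmul]
      simpa using posPart_eq_zero.1 h0
    rcases Nat.eq_zero_or_pos n with rfl | hpos
    · simpa using he
    have hn0 : (0 : ℝ) < n := Nat.cast_pos.2 hpos
    have h2 : y ≤ (n : ℝ)⁻¹ • e := by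
      have := smul_le_smul_of_nonneg_left h1 (inv_nonneg.2 hn0.le)
      rwa [smul_smul, inv_mul_cancel₀ hn0.ne', one_smul] at this
    have h3 : y⁺ ≤ (n : ℝ)⁻¹ • e := sup_le h2 (smul_nonneg (inv_nonneg.2 hn0.le) he)
    have h4 := smul_le_smul_of_nonneg_left h3 hn0.le
    rwa [smul_smul, mul_inv_cancel₀ hn0.ne', one_smul, Nat.cast_smul_eq_nsmul] at h4
  obtain ⟨P, hPs, hzP, hprime⟩ := exists_prime_solid hz
  -- `T v` means `v ≥ 0` modulo `P`; primeness makes this order on the quotient total.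
  set T : L → Prop := fun v => v⁻ ∈ P with hT
  have mem_of_le : ∀ {v w : L}, 0 ≤ v → v ≤ w → w ∈ P → v ∈ P := by
    intro v w hv hvw hw
    exact hPs hw (by rw [abs_of_nonneg hv, abs_of_nonneg (hv.trans hvw)]; exact hvw)
  have Tadd : ∀ {v w}, T v → T w → T (v + w) := fun {v w} hv hw =>
    mem_of_le (negPart_nonneg _) (negPart_add_le v w) (P.add_mem hv hw)
  have Tsmul : ∀ {t : ℝ} {v}, 0 ≤ t → T v → T (t • v) := fun {t v} ht hv =>
    mem_of_le (negPart_nonneg _) (negPart_smul_le ht v) (P.smul_mem _ hv)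
  have Tpos : ∀ {v}, 0 ≤ v → T v := fun {v} hv => by
    simp only [hT, negPart_eq_zero.2 hv]; exact P.zero_mem
  have Ttot : ∀ v, T v ∨ T (-v) := fun v => by
    simp only [hT, negPart_neg]
    exact (hprime _ _ (posPart_inf_negPart_eq_zero v)).symm
  have Te : ¬ T (-e) := by
    simp only [hT, negPart_neg, posPart_eq_self.2 he]
    intro heP
    obtain ⟨k, hk⟩ := hunit (n • y - e)⁺
    exact hzP (mem_of_le (posPart_nonneg _) hk (P.smul_of_tower_mem k heP))
  have Tneg : ∀ {t : ℝ}, T (t • e) → 0 ≤ t := by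
    intro t ht
    by_contra! hlt
    apply Te
    have := Tsmul (t := (-t)⁻¹) (inv_nonneg.2 (by linarith)) ht
    rwa [smul_smul, inv_neg, neg_mul, inv_mul_cancel₀ hlt.ne, neg_smul, one_smul] at this
  -- The quotient may contain infinitesimals relative to `e`, so `r` is the value of `v` only up to
  -- these: `v` lies between `(r - ε) • e` and `(r + ε) • e` modulo `P` for every `ε`. The value
  -- exists as the supremum of a Dedekind cut.
  let V : L → ℝ → Prop := fun v r => ∀ ε : ℝ, 0 < ε → T (v - (r - ε) • e) ∧ T ((r + ε) • e - v)
  have Vle : ∀ {v w r s}, V v r → V w s → T (w - v) → r ≤ s := by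
    intro v w r s hr hs hvw
    refine le_of_forall_pos_le_add fun ε hε => ?_
    have := Tadd (Tadd (hr (ε / 2) (by positivity)).1 (hs (ε / 2) (by positivity)).2) hvw
    have h2 : v - (r - ε / 2) • e + ((s + ε / 2) • e - w) + (w - v) = (s + ε - r) • e := by
      module
    rw [h2] at this
    have := Tneg this
    linarith
  have Vuniq : ∀ {v r s}, V v r → V v s → r = s := fun {v r s} hr hs =>
    le_antisymm (Vle hr hs (Tpos (by simp))) (Vle hs hr (Tpos (by simp)))
  have Vex : ∀ v, ∃ r, V v r := by
    intro v
    let S : Set ℝ := {t | T (v - t • e)}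
    obtain ⟨k, hk⟩ := hunit v
    obtain ⟨l, hl⟩ := hunit (-v)
    have hne : S.Nonempty := by
      refine ⟨-(l : ℝ), Tpos ?_⟩
      have : (l : ℝ) • e = l • e := Nat.cast_smul_eq_nsmul ℝ l e
      rw [neg_smul, this, sub_neg_eq_add]
      simpa [add_comm] using add_le_add_left hl v
    have hbdd : BddAbove S := by
      refine ⟨k, fun t ht => ?_⟩
      have h1 : T ((k : ℝ) • e - v) := Tpos (by
        rw [Nat.cast_smul_eq_nsmul]; exact sub_nonneg.2 hk)
      have h2 := Tadd h1 ht
      rw [show (k : ℝ) • e - v + (v - t • e) = ((k : ℝ) - t) • e by module] at h2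
      linarith [Tneg h2]
    refine ⟨sSup S, fun ε hε => ⟨?_, ?_⟩⟩
    · obtain ⟨t, ht, hlt⟩ := exists_lt_of_lt_csSup hne (show sSup S - ε < sSup S by linarith)
      have := Tadd ht (Tpos (smul_nonneg (sub_nonneg.2 hlt.le) he))
      rwa [show v - t • e + (t - (sSup S - ε)) • e = v - (sSup S - ε) • e by module] at this
    · rcases Ttot (v - (sSup S + ε) • e) with h | h
      · have := le_csSup hbdd h
        linarith
      · rwa [neg_sub] at h
  choose f hf using Vex
  have Vadd : ∀ v w, V (v + w) (f v + f w) := fun v w ε hε => by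
    have h1 := hf v (ε / 2) (by positivity)
    have h2 := hf w (ε / 2) (by positivity)
    constructor
    · convert Tadd h1.1 h2.1 using 1; module
    · convert Tadd h1.2 h2.2 using 1; module
  have Vsmul_pos : ∀ (t : ℝ) v, 0 < t → V (t • v) (t * f v) := fun t v ht ε hε => by
    have h1 := hf v (ε / t) (by positivity)
    have h2 : t * (ε / t) = ε := by field_simp
    constructor
    · convert Tsmul ht.le h1.1 using 1
      rw [smul_sub, smul_smul, mul_sub, h2]
    · convert Tsmul ht.le h1.2 using 1
      rw [smul_sub, smul_smul, mul_add, h2]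
  have fadd : ∀ v w, f (v + w) = f v + f w := fun v w => Vuniq (hf _) (Vadd v w)
  have fzero : f 0 = 0 := by simpa using fadd 0 0
  have fneg : ∀ v, f (-v) = - f v := fun v => by
    have := fadd v (-v)
    rw [add_neg_cancel, fzero] at this
    linarith
  have fsmul : ∀ (t : ℝ) v, f (t • v) = t * f v := by
    intro t v
    rcases lt_trichotomy t 0 with ht | ht | ht
    · have h1 := Vuniq (hf _) (Vsmul_pos (-t) v (by linarith))
      rw [neg_smul, fneg] at h1
      linarith
    · simp [ht, fzero]
    · exact Vuniq (hf _) (Vsmul_pos t v ht)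
  have fmono : ∀ {v w}, T (w - v) → f v ≤ f w := fun h => Vle (hf _) (hf _) h
  have fP : ∀ {v}, v ∈ P → f v = 0 := by
    intro v hv
    have h1 : T v := hPs hv (by
      rw [abs_of_nonneg (negPart_nonneg v)]
      exact sup_le (neg_le_abs v) (abs_nonneg v))
    have h2 : T (-v) := hPs hv (by
      rw [abs_of_nonneg (negPart_nonneg _), negPart_neg]
      exact sup_le (le_abs_self v) (abs_nonneg v))
    apply le_antisymm
    · rw [← fzero]; exact fmono (by simpa using h2)
    · rw [← fzero]; exact fmono (by simpa using h1)
  -- If `v ≤ w` modulo `P`, then `v ⊔ w = w + (v - w)⁺` and the last term lies in `P`, where `f`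
  -- vanishes.
  have fsup : ∀ v w, f (v ⊔ w) = f v ⊔ f w := by
    have key : ∀ v w, T (w - v) → f (v ⊔ w) = f v ⊔ f w := by
      intro v w h
      rw [sup_eq_add_posPart_sub, fadd, sup_eq_right.2 (fmono h)]
      have : (v - w)⁺ ∈ P := by
        rw [← negPart_neg, neg_sub]; exact h
      rw [fP this, add_zero]
    intro v w
    rcases Ttot (w - v) with h | h
    · exact key v w h
    · rw [neg_sub] at h
      rw [sup_comm, key w v h, sup_comm]
  have finf : ∀ v w, f (v ⊓ w) = f v ⊓ f w := by
    intro v w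
    have h1 := congrArg f (inf_add_sup v w)
    rw [fadd, fadd, fsup] at h1
    have h2 := inf_add_sup (f v) (f w)
    linarith
  have fe : 1 ≤ f e := by
    have hV : V e 1 := fun ε hε => by
      constructor
      · convert Tpos (smul_nonneg hε.le he) using 1; module
      · convert Tpos (smul_nonneg hε.le he) using 1; module
    exact (Vuniq (hf e) hV).ge
  have hpos : 0 < f y := by
    have h1 : T (n • y - e) := by
      rcases hprime _ _ (posPart_inf_negPart_eq_zero (n • y - e)) with h | h
      · exact absurd h hzP
      · exact h
    have h2 := fmono h1
    rw [← Nat.cast_smul_eq_nsmul ℝ, fsmul] at h2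
    by_contra! h3
    have : (n : ℝ) * f y ≤ 0 := mul_nonpos_of_nonneg_of_nonpos (Nat.cast_nonneg n) h3
    linarith
  refine ⟨{ toFun := f, map_add' := fadd, map_smul' := fsmul }, ⟨?_, fun v w => ⟨fsup v w, finf v w⟩⟩,
    hpos⟩
  intro h0
  have : f y = 0 := by
    simpa using congrArg (fun g : L →ₗ[ℝ] ℝ => g y) h0
  exact hpos.ne' this

end Separation

/-! ### Inequalities in `E` tested on finitely generated sublattices. -/

section Transfer

variable {E : Type*} [AddCommGroup E] [Lattice E] [Module ℝ E]

/-- The linear functional `ω` on `E` preserves the lattice operations on the subspace `S`. -/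
def IsHomOn (S : Submodule ℝ E) (ω : E →ₗ[ℝ] ℝ) : Prop :=
  ∀ x ∈ S, ∀ y ∈ S, ω (x ⊔ y) = ω x ⊔ ω y ∧ ω (x ⊓ y) = ω x ⊓ ω y

theorem latticeSpan_le {A : Set E} {S : Submodule ℝ E} (hS : IsVectorSublattice S) (hA : A ⊆ S) :
    latticeSpan A ≤ S :=
  sInf_le ⟨hS, hA⟩

theorem latticeSpan_mono {A B : Set E} (h : A ⊆ B) : latticeSpan A ≤ latticeSpan B :=
  latticeSpan_le (isVectorSublattice_latticeSpan B) (h.trans (subset_latticeSpan B))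

theorem IsHomOn.mono {S T : Submodule ℝ E} {ω : E →ₗ[ℝ] ℝ} (h : IsHomOn T ω) (hST : S ≤ T) :
    IsHomOn S ω := fun x hx y hy => h x (hST hx) y (hST hy)

theorem IsHomOn.monotone {S : Submodule ℝ E} {ω : E →ₗ[ℝ] ℝ} (h : IsHomOn S ω) {x y : E}
    (hx : x ∈ S) (hy : y ∈ S) (hxy : x ≤ y) : ω x ≤ ω y := by
  have := (h x hx y hy).1
  rw [sup_eq_right.2 hxy] at this
  rw [this]
  exact le_sup_left

theorem sup'_mem_and_map {S : Submodule ℝ E} (hS : IsVectorSublattice S) {ι : Type*}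
    {F : Finset ι} (hF : F.Nonempty) {g : ι → E} (hg : ∀ i ∈ F, g i ∈ S) :
    F.sup' hF g ∈ S ∧
      ∀ ω : E →ₗ[ℝ] ℝ, IsHomOn S ω → ω (F.sup' hF g) = F.sup' hF fun i => ω (g i) := by
  induction hF using Finset.Nonempty.cons_induction with
  | singleton i => exact ⟨by simpa using hg i (by simp), by simp⟩
  | cons i s hi hs ih =>
    obtain ⟨h1, h2⟩ := ih fun j hj => hg j (Finset.mem_cons_of_mem hj)
    have hgi := hg i (Finset.mem_cons_self i s)
    simp only [Finset.sup'_cons hs]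
    refine ⟨(hS _ hgi _ h1).1, fun ω hω => ?_⟩
    rw [(hω _ hgi _ h1).1, h2 ω hω]

/-- The values of a functional on a tuple, as a point of Euclidean space. -/
def evalVec {m : ℕ} (ω : E →ₗ[ℝ] ℝ) (a : Fin m → E) : EuclideanSpace ℝ (Fin m) :=
  WithLp.toLp 2 fun k => ω (a k)

theorem evalVec_apply {F : Type*} [AddCommGroup F] [Module ℝ F] {m : ℕ} (ω : F →ₗ[ℝ] ℝ)
    (a : Fin m → F) (k : Fin m) :
    evalVec ω a k = ω (a k) := rfl

theorem posHom_zero {m : ℕ} {h : EuclideanSpace ℝ (Fin m) → ℝ} (hh : h ∈ posHom m) : h 0 = 0 := by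
  simpa using hh.2 0 le_rfl 0

/-- Functionals on the sublattice extend linearly to `E`, so one functional can be used on several
sublattices without coercions. The zero functional may be admitted because `h 0 = 0`. -/
theorem calcEq_iff {m : ℕ} {h : EuclideanSpace ℝ (Fin m) → ℝ} (hh : h ∈ posHom m)
    (a : Fin m → E) (b : E) :
    CalcEq h a b ↔ ∀ ω : E →ₗ[ℝ] ℝ, IsHomOn (latticeSpan (insert b (Set.range a))) ω →
      h (evalVec ω a) = ω b := by
  constructor
  · intro H ω hω
    let ω' := ω.domRestrict (latticeSpan (insert b (Set.range a)))
    by_cases h0 : ω' = 0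
    · have hz : ∀ x ∈ latticeSpan (insert b (Set.range a)), ω x = 0 := fun x hx => by
        simpa [ω'] using congrArg (fun g => g ⟨x, hx⟩) h0
      have : evalVec ω a = 0 := by
        ext k
        exact hz _ (subset_latticeSpan _ (Set.mem_insert_of_mem b (Set.mem_range_self k)))
      rw [this, posHom_zero hh, hz b (subset_latticeSpan _ (Set.mem_insert b _))]
    · exact H ω' ⟨h0, fun x y => hω x x.2 y y.2⟩
  · intro H ω hω
    obtain ⟨g, hg⟩ := LinearMap.exists_extend ω
    have hval : ∀ x : latticeSpan (insert b (Set.range a)), g x = ω x := fun x => by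
      rw [← hg]; rfl
    have := H g fun x hx y hy => by
      have h1 := hω.2 ⟨x, hx⟩ ⟨y, hy⟩
      rw [← hval, ← hval, ← hval, ← hval] at h1
      exact h1
    rw [← hval, ← this]
    congr 1
    ext k
    exact (hval _).symm

variable [IsOrderedAddMonoid E]

theorem isVectorSublattice_of_isSolid {S : Submodule ℝ E}
    (hS : LatticeOrderedAddCommGroup.IsSolid (S : Set E)) : IsVectorSublattice S := by
  intro x hx y hy
  have hmem : |x| + |y| ∈ S :=
    S.add_mem (hS hx (by rw [abs_abs])) (hS hy (by rw [abs_abs]))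
  have h1 : |x| ≤ |x| + |y| := le_add_of_nonneg_right (abs_nonneg y)
  have h2 : |y| ≤ |x| + |y| := le_add_of_nonneg_left (abs_nonneg x)
  refine ⟨hS hmem ((sup_le ?_ ?_).trans (le_abs_self _)),
    hS hmem ((sup_le ?_ ?_).trans (le_abs_self _))⟩
  · exact sup_le ((le_abs_self x).trans h1) ((le_abs_self y).trans h2)
  · exact (neg_le_neg le_sup_left).trans ((neg_le_abs x).trans h1)
  · exact inf_le_left.trans ((le_abs_self x).trans h1)
  · rw [neg_inf]
    exact sup_le ((neg_le_abs x).trans h1) ((neg_le_abs y).trans h2)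

instance (A : Set E) : IsOrderedAddMonoid (latticeSpan A) where
  add_le_add_left := fun x y hxy z =>
    show (x : E) + z ≤ y + z from add_le_add_left (show (x : E) ≤ y from hxy) z

variable [IsOrderedModule ℝ E]

instance (A : Set E) : IsOrderedModule ℝ (latticeSpan A) where
  smul_le_smul_of_nonneg_left := fun t ht x y hxy =>
    show t • (x : E) ≤ t • (y : E) from
      smul_le_smul_of_nonneg_left (show (x : E) ≤ y from hxy) ht
  smul_le_smul_of_nonneg_right := fun x hx s t hst =>
    show s • (x : E) ≤ t • (x : E) from
      smul_le_smul_of_nonneg_right hst (show (0 : E) ≤ x from hx)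

/-- The sum `e` of the `|x|`, `x ∈ A`, is a strong unit of `latticeSpan A`: the solid subspace
generated by `e` is a vector sublattice containing `A`. -/
theorem exists_isHomOn_pos (hE : IsArchimedean E) {A : Set E} (hA : A.Finite) {y : E}
    (hyA : y ∈ latticeSpan A) (hy : ¬ y ≤ 0) :
    ∃ ω : E →ₗ[ℝ] ℝ, IsHomOn (latticeSpan A) ω ∧ 0 < ω y := by
  set e : E := ∑ x ∈ hA.toFinset, |x| with he
  have he0 : 0 ≤ e := Finset.sum_nonneg fun x _ => abs_nonneg x
  have heA : e ∈ latticeSpan A := Submodule.sum_mem _ fun x hx => by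
    have hx' := subset_latticeSpan A (hA.mem_toFinset.1 hx)
    exact (isVectorSublattice_latticeSpan A x hx' (-x) (Submodule.neg_mem _ hx')).1
  have hle : latticeSpan A ≤ solidAdjoin ⊥ e :=
    latticeSpan_le (isVectorSublattice_of_isSolid (isSolid_solidAdjoin ⊥ e)) fun x hx =>
      ⟨0, Submodule.zero_mem _, 1, zero_le_one, by
        rw [one_smul, zero_add]
        exact Finset.single_le_sum (f := fun x : E => |x|) (fun x _ => abs_nonneg x)
          (hA.mem_toFinset.2 hx)⟩
  have hunit : ∀ v : latticeSpan A, ∃ n : ℕ, v ≤ n • (⟨e, heA⟩ : latticeSpan A) := by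
    intro v
    obtain ⟨p, hp, r, hr, h1⟩ := hle v.2
    obtain ⟨n, hn⟩ := exists_nat_ge r
    refine ⟨n, show (v : E) ≤ n • e from ?_⟩
    rw [(Submodule.mem_bot ℝ).1 hp, zero_add] at h1
    rw [← Nat.cast_smul_eq_nsmul ℝ]
    exact (le_abs_self _).trans (h1.trans (smul_le_smul_of_nonneg_right hn he0))
  have harch : IsArchimedean (latticeSpan A) := fun x z hx hxz =>
    Subtype.ext (hE x z hx fun n => hxz n)
  obtain ⟨ω, hω, hpos⟩ := exists_realHom_pos harch (e := ⟨e, heA⟩) he0 hunit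
    (y := ⟨y, hyA⟩) hy
  obtain ⟨g, hg⟩ := LinearMap.exists_extend ω
  have hval : ∀ x : latticeSpan A, g x = ω x := fun x => by rw [← hg]; rfl
  refine ⟨g, fun x hx z hz => ?_, ?_⟩
  · have h1 := hω.2 ⟨x, hx⟩ ⟨z, hz⟩
    rw [← hval, ← hval, ← hval, ← hval] at h1
    exact h1
  · rw [← hval] at hpos
    exact hpos

theorem le_of_forall_isHomOn (hE : IsArchimedean E) {A : Set E} (hA : A.Finite) {x y : E}
    (hx : x ∈ latticeSpan A) (hy : y ∈ latticeSpan A)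
    (H : ∀ ω : E →ₗ[ℝ] ℝ, IsHomOn (latticeSpan A) ω → ω x ≤ ω y) : x ≤ y := by
  by_contra hcon
  obtain ⟨ω, hω, hpos⟩ := exists_isHomOn_pos hE hA (Submodule.sub_mem _ hx hy)
    (fun h => hcon (sub_nonpos.1 h))
  rw [map_sub] at hpos
  linarith [H ω hω]

end Transfer

/-! ### From approximation of `h` by linearizations to suprema in `E`. -/

section Linearization

variable {m : ℕ} {E : Type*} [AddCommGroup E] [Lattice E] [Module ℝ E]

/-- `∇h(c) · x` for `x` in Euclidean space. -/
noncomputable def gradLin (h : EuclideanSpace ℝ (Fin m) → ℝ) (c x : EuclideanSpace ℝ (Fin m)) : ℝ :=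
  ∑ k, partialD h k c * x k

theorem map_gradDot {F : Type*} [AddCommGroup F] [Module ℝ F] (ω : F →ₗ[ℝ] ℝ)
    (h : EuclideanSpace ℝ (Fin m) → ℝ) (c : EuclideanSpace ℝ (Fin m)) (a : Fin m → F) :
    ω (gradDot h c a) = gradLin h c (evalVec ω a) := by
  simp [gradDot, gradLin, evalVec_apply]

theorem gradDot_mem {F : Type*} [AddCommGroup F] [Module ℝ F] {S : Submodule ℝ F}
    {a : Fin m → F} (haS : ∀ k, a k ∈ S)
    (h : EuclideanSpace ℝ (Fin m) → ℝ) (c : EuclideanSpace ℝ (Fin m)) : gradDot h c a ∈ S :=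
  Submodule.sum_mem _ fun k _ => Submodule.smul_mem _ _ (haS k)

theorem evalVec_mem_orthant {S : Submodule ℝ E} {ω : E →ₗ[ℝ] ℝ} (hω : IsHomOn S ω)
    {a : Fin m → E} (haS : ∀ k, a k ∈ S) (ha : ∀ k, 0 ≤ a k) : evalVec ω a ∈ orthant m := by
  intro k
  have := hω.monotone S.zero_mem (haS k) (ha k)
  rwa [map_zero] at this

variable [IsOrderedAddMonoid E] [IsOrderedModule ℝ E]

theorem gradDot_le_of_calcEq (hE : IsArchimedean E) {h : EuclideanSpace ℝ (Fin m) → ℝ}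
    (hh : h ∈ posHom m) {a : Fin m → E} (ha : ∀ k, 0 ≤ a k) {b : E} (hb : CalcEq h a b)
    {c : EuclideanSpace ℝ (Fin m)} (hc : ∀ x ∈ orthant m, gradLin h c x ≤ h x) :
    gradDot h c a ≤ b := by
  have haS : ∀ k, a k ∈ latticeSpan (insert b (Set.range a)) := fun k =>
    subset_latticeSpan _ (Set.mem_insert_of_mem b (Set.mem_range_self k))
  refine le_of_forall_isHomOn hE ((Set.finite_range a).insert b) (gradDot_mem haS h c)
    (subset_latticeSpan _ (Set.mem_insert b _)) fun ω hω => ?_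
  rw [map_gradDot, ← (calcEq_iff hh a b).1 hb ω hω]
  exact hc _ (evalVec_mem_orthant hω haS ha)

/-- If finitely many linearizations of `h` approximate `h` up to `ε ∑ xₖ` on the orthant, then
their supremum approximates from below every element dominated by `h(a)`. -/
theorem le_sup'_gradDot_add (hE : IsArchimedean E) {h : EuclideanSpace ℝ (Fin m) → ℝ}
    {a : Fin m → E} (ha : ∀ k, 0 ≤ a k) {ι : Type*} {F : Finset ι} (hF : F.Nonempty)
    (c : ι → EuclideanSpace ℝ (Fin m)) {ε : ℝ}
    (happrox : ∀ x ∈ orthant m, ∃ i ∈ F, h x ≤ gradLin h (c i) x + ε * ∑ k, x k) {A : Set E}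
    (hA : A.Finite) (haA : Set.range a ⊆ A) {g : E} (hgA : g ∈ latticeSpan A)
    (hg : ∀ ω : E →ₗ[ℝ] ℝ, IsHomOn (latticeSpan A) ω → ω g ≤ h (evalVec ω a)) :
    g ≤ F.sup' hF (fun i => gradDot h (c i) a) + ε • ∑ k, a k := by
  have haS : ∀ k, a k ∈ latticeSpan A := fun k => subset_latticeSpan _ (haA (Set.mem_range_self k))
  obtain ⟨h1, h2⟩ := sup'_mem_and_map (isVectorSublattice_latticeSpan A) hF
    (g := fun i => gradDot h (c i) a) fun i _ => gradDot_mem haS h (c i)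
  refine le_of_forall_isHomOn hE hA hgA (Submodule.add_mem _ h1 (Submodule.smul_mem _ _
    (Submodule.sum_mem _ fun k _ => haS k))) fun ω hω => ?_
  obtain ⟨i, hi, hle⟩ := happrox _ (evalVec_mem_orthant hω haS ha)
  have h3 : gradLin h (c i) (evalVec ω a) ≤ F.sup' hF fun i => ω (gradDot h (c i) a) := by
    rw [← map_gradDot]
    exact Finset.le_sup' (fun i => ω (gradDot h (c i) a)) hi
  rw [map_add, map_smul, map_sum, h2 ω hω, smul_eq_mul]
  have := hg ω hω
  simp only [evalVec_apply] at hle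
  linarith

/-- The vectors `c ∈ D` support `h` on the orthant, and finitely many of the corresponding
linearizations approximate `h` up to any prescribed error. -/
def ApproxBy (h : EuclideanSpace ℝ (Fin m) → ℝ) (D : Set (EuclideanSpace ℝ (Fin m))) : Prop :=
  (∀ c ∈ D, ∀ x ∈ orthant m, gradLin h c x ≤ h x) ∧
    ∀ ε : ℝ, 0 < ε → ∃ F : Finset (EuclideanSpace ℝ (Fin m)), ↑F ⊆ D ∧
      ∀ x ∈ orthant m, ∃ c ∈ F, h x ≤ gradLin h c x + ε * ∑ k, x k

theorem zero_mem_orthant : (0 : EuclideanSpace ℝ (Fin m)) ∈ orthant m := fun _ => le_rfl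

theorem calcEq_iff_isLUB (hE : IsArchimedean E) {h : EuclideanSpace ℝ (Fin m) → ℝ}
    (hh : h ∈ posHom m) {a : Fin m → E} (ha : ∀ k, 0 ≤ a k)
    {D : Set (EuclideanSpace ℝ (Fin m))} (hD : ApproxBy h D) (b : E) :
    CalcEq h a b ↔ IsLUB {x | ∃ c ∈ D, x = gradDot h c a} b := by
  constructor
  · intro hb
    refine ⟨?_, fun u hu => ?_⟩
    · rintro _ ⟨c, hc, rfl⟩
      exact gradDot_le_of_calcEq hE hh ha hb (hD.1 c hc)
    -- The upper bound `u` need not lie in the sublattice of `a` and `b`, so the test is made on a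
    -- larger one and `ω` is restricted to evaluate `b`.
    · set A : Set E := insert u (insert b (Set.range a))
      have hsub : insert b (Set.range a) ⊆ A := Set.subset_insert _ _
      have haS : ∀ k, a k ∈ latticeSpan A := fun k =>
        subset_latticeSpan _ (hsub (Set.mem_insert_of_mem b (Set.mem_range_self k)))
      refine le_of_forall_isHomOn hE (((Set.finite_range a).insert b).insert u)
        (subset_latticeSpan _ (hsub (Set.mem_insert b _)))
        (subset_latticeSpan _ (Set.mem_insert u _)) fun ω hω => ?_
      rw [← (calcEq_iff hh a b).1 hb ω (hω.mono (latticeSpan_mono hsub))]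
      have hx := evalVec_mem_orthant hω haS ha
      set x := evalVec ω a
      have hs : 0 ≤ ∑ k, x k := Finset.sum_nonneg fun k _ => hx k
      refine le_of_forall_pos_le_add fun δ hδ => ?_
      -- The `1` guards against `∑ k, x k = 0`.
      obtain ⟨F, hF, happ⟩ := hD.2 (δ / (∑ k, x k + 1)) (by positivity)
      obtain ⟨c, hc, hle⟩ := happ x hx
      have h1 : gradLin h c x ≤ ω u := by
        rw [← map_gradDot]
        exact hω.monotone (gradDot_mem haS h c) (subset_latticeSpan _ (Set.mem_insert u _))
          (hu ⟨c, hF hc, rfl⟩)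
      have h2 : δ / (∑ k, x k + 1) * ∑ k, x k ≤ δ := by
        rw [div_mul_eq_mul_div, div_le_iff₀ (by positivity)]
        nlinarith
      linarith
  · intro hb
    rw [calcEq_iff hh]
    intro ω hω
    have hbS := subset_latticeSpan _ (Set.mem_insert b (Set.range a))
    have haS : ∀ k, a k ∈ latticeSpan (insert b (Set.range a)) := fun k =>
      subset_latticeSpan _ (Set.mem_insert_of_mem b (Set.mem_range_self k))
    have hx := evalVec_mem_orthant hω haS ha
    set x := evalVec ω a with hxdef
    have hs : 0 ≤ ∑ k, x k := Finset.sum_nonneg fun k _ => hx k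
    have key : ∀ δ : ℝ, 0 < δ → h x ≤ ω b + δ ∧ ω b ≤ h x + δ := by
      intro δ hδ
      set ε := δ / (∑ k, x k + 1) with hε
      have hεs : ε * ∑ k, x k ≤ δ := by
        rw [hε, div_mul_eq_mul_div, div_le_iff₀ (by positivity)]
        nlinarith
      obtain ⟨F, hF, happ⟩ := hD.2 ε (by positivity)
      have hFne : F.Nonempty := by
        obtain ⟨c, hc, -⟩ := happ 0 zero_mem_orthant
        exact ⟨c, hc⟩
      constructor
      · obtain ⟨c, hc, hle⟩ := happ x hx
        have h1 : gradLin h c x ≤ ω b := by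
          rw [hxdef, ← map_gradDot]
          exact hω.monotone (gradDot_mem haS h c) hbS (hb.1 ⟨c, hF hc, rfl⟩)
        linarith
      · obtain ⟨h1, h2⟩ := sup'_mem_and_map (isVectorSublattice_latticeSpan _) hFne
          (g := fun c => gradDot h c a) fun c _ => gradDot_mem haS h c
        -- The right side is an upper bound of the whole family, so the least upper bound `b` lies
        -- below it. Only a finite supremum remains, and `ω` preserves it.
        have hle : b ≤ F.sup' hFne (fun c => gradDot h c a) + ε • ∑ k, a k := by
          refine hb.2 ?_
          rintro _ ⟨c, hc, rfl⟩
          have haS' : ∀ k, a k ∈ latticeSpan (Set.range a) := fun k =>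
            subset_latticeSpan _ (Set.mem_range_self k)
          refine le_sup'_gradDot_add hE ha hFne id happ (Set.finite_range a) subset_rfl
            (gradDot_mem haS' h c) fun ω' hω' => ?_
          rw [map_gradDot]
          exact hD.1 c hc _ (evalVec_mem_orthant hω' haS' ha)
        have h3 := hω.monotone hbS (Submodule.add_mem _ h1 (Submodule.smul_mem _ _
          (Submodule.sum_mem _ fun k _ => haS k))) hle
        rw [map_add, map_smul, map_sum, h2 ω hω, smul_eq_mul] at h3
        have h4 : (F.sup' hFne fun c => ω (gradDot h c a)) ≤ h x :=
          Finset.sup'_le _ _ fun c hc => by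
            rw [map_gradDot]
            exact hD.1 c (hF hc) x hx
        have h5 : ∑ k, ω (a k) = ∑ k, x k := rfl
        rw [h5] at h3
        linarith
    exact le_antisymm (le_of_forall_pos_le_add fun δ hδ => (key δ hδ).1)
      (le_of_forall_pos_le_add fun δ hδ => (key δ hδ).2)

/-- Halving `ε` secures strictness: `(ε / 2) • p ≠ ε • p` because `p ≠ 0`. -/
theorem abs_sub_lt_smul {u v s p : E} {ε : ℝ} (hε : 0 < ε) (hu : u ≤ v)
    (hv : v ≤ u + (ε / 2) • s) (hsp : s ≤ p) (hp : 0 < p) : |u - v| < ε • p := by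
  have h1 : |u - v| ≤ (ε / 2) • p := by
    rw [abs_sub_comm, abs_of_nonneg (sub_nonneg.2 hu)]
    exact (sub_le_iff_le_add'.2 hv).trans (smul_le_smul_of_nonneg_left hsp (by positivity))
  refine h1.trans_lt (lt_of_le_of_ne (smul_le_smul_of_nonneg_right (by linarith) hp.le) ?_)
  intro h2
  have h3 : (ε / 2) • p = 0 := by
    have : ε • p = (ε / 2) • p + (ε / 2) • p := by rw [← add_smul]; congr 1; ring
    rw [this] at h2
    simpa using h2
  rcases smul_eq_zero.1 h3 with h4 | h4
  · linarith
  · exact hp.ne' h4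

theorem ruConverges_gridSup (hE : IsArchimedean E) [Nontrivial E]
    {h : EuclideanSpace ℝ (Fin m) → ℝ} (hh : h ∈ posHom m) {a : Fin m → E} (ha : ∀ k, 0 ≤ a k)
    (hsupp : ∀ c ∈ gridPoints m, ∀ x ∈ orthant m, gradLin h c x ≤ h x)
    (happ : ∀ ε : ℝ, 0 < ε → ∃ N : ℕ, ∀ n ≥ N, ∀ x ∈ orthant m,
      ∃ θ ∈ grid m n, h x ≤ gradLin h (sph θ) x + ε * ∑ k, x k)
    {b : E} (hb : CalcEq h a b) : RUConverges (gridSup h a) b := by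
  -- The natural regulator `∑ k, a k` may be zero; adding `|u|` makes it strictly positive.
  obtain ⟨u, hu⟩ := exists_ne (0 : E)
  have hu' : 0 < |u| := by
    refine lt_of_le_of_ne (abs_nonneg u) fun h0 => hu ?_
    exact le_antisymm (h0 ▸ le_abs_self u) (neg_nonpos.1 (h0 ▸ neg_le_abs u))
  have hs : 0 ≤ ∑ k, a k := Finset.sum_nonneg fun k _ => ha k
  refine ⟨∑ k, a k + |u|, add_pos_of_nonneg_of_pos hs hu', fun ε hε => ?_⟩
  obtain ⟨N, hN⟩ := happ (ε / 2) (by positivity)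
  -- `gridPoints` only collects grids with `n ≥ 1`.
  refine ⟨max N 1, fun n hn => ?_⟩
  refine abs_sub_lt_smul hε ?_ ?_ (le_add_of_nonneg_right hu'.le)
    (add_pos_of_nonneg_of_pos hs hu')
  · exact Finset.sup'_le _ _ fun θ hθ => gradDot_le_of_calcEq hE hh ha hb
      (hsupp _ ⟨n, (le_max_right _ _).trans hn, θ, hθ, rfl⟩)
  · exact le_sup'_gradDot_add hE ha (grid_nonempty m n) sph (hN n ((le_max_left _ _).trans hn))
      ((Set.finite_range a).insert b) (Set.subset_insert _ _)
      (subset_latticeSpan _ (Set.mem_insert b _))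
      fun ω hω => ((calcEq_iff hh a b).1 hb ω hω).ge

end Linearization

/-! ### Linear minorants of a convex positively homogeneous function. -/

section Support

variable {m : ℕ} {h : EuclideanSpace ℝ (Fin m) → ℝ}

theorem gradLin_add (h : EuclideanSpace ℝ (Fin m) → ℝ) (c x y : EuclideanSpace ℝ (Fin m)) :
    gradLin h c (x + y) = gradLin h c x + gradLin h c y := by
  simp [gradLin, mul_add, Finset.sum_add_distrib]

theorem gradLin_smul (h : EuclideanSpace ℝ (Fin m) → ℝ) (c : EuclideanSpace ℝ (Fin m)) (t : ℝ)
    (x : EuclideanSpace ℝ (Fin m)) : gradLin h c (t • x) = t * gradLin h c x := by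
  simp [gradLin, Finset.mul_sum, mul_left_comm]

theorem gradLin_sub (h : EuclideanSpace ℝ (Fin m) → ℝ) (c x y : EuclideanSpace ℝ (Fin m)) :
    gradLin h c (x - y) = gradLin h c x - gradLin h c y := by
  simp [gradLin, mul_sub, Finset.sum_sub_distrib]

theorem continuous_gradLin (h : EuclideanSpace ℝ (Fin m) → ℝ) (c : EuclideanSpace ℝ (Fin m)) :
    Continuous (gradLin h c) := by
  unfold gradLin
  fun_prop

theorem smul_mem_orthant {t : ℝ} (ht : 0 ≤ t) {x : EuclideanSpace ℝ (Fin m)}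
    (hx : x ∈ orthant m) : t • x ∈ orthant m := fun k => mul_nonneg ht (hx k)

variable (m) in
/-- The open positive orthant. -/
def openOrthant : Set (EuclideanSpace ℝ (Fin m)) := {x | ∀ k, 0 < x k}

theorem isOpen_openOrthant : IsOpen (openOrthant m) := by
  have : openOrthant m = ⋂ k : Fin m, {x | 0 < x k} := by ext; simp [openOrthant]
  rw [this]
  exact isOpen_iInter_of_finite fun k => isOpen_lt continuous_const (by fun_prop)

theorem openOrthant_subset : openOrthant m ⊆ orthant m := fun _ hx k => (hx k).le

theorem convex_openOrthant : Convex ℝ (openOrthant m) := by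
  intro x hx y hy s t hs ht hst k
  rcases hs.eq_or_lt with rfl | hs'
  · have : t = 1 := by linarith
    simpa [this] using hy k
  · exact add_pos_of_pos_of_nonneg (mul_pos hs' (hx k)) (mul_nonneg ht (hy k).le)

/-- Evaluating the tangent inequality at `0` and at `2c` gives the two halves of Euler's identity
`∇h(c) · c = h(c)`, which removes the constant term. -/
theorem gradLin_support_of_tangent (hh : h ∈ posHom m) {c : EuclideanSpace ℝ (Fin m)}
    (hc : c ∈ orthant m) (H : ∀ x ∈ orthant m, h c + gradLin h c (x - c) ≤ h x) :
    (∀ x ∈ orthant m, gradLin h c x ≤ h x) ∧ gradLin h c c = h c := by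
  have h0 := H 0 zero_mem_orthant
  have h2 := H ((2 : ℝ) • c) (smul_mem_orthant zero_le_two hc)
  rw [posHom_zero hh, gradLin_sub, show gradLin h c 0 = 0 by simp [gradLin]] at h0
  rw [hh.2 2 zero_le_two, gradLin_sub, gradLin_smul] at h2
  have h3 : gradLin h c c = h c := by linarith
  refine ⟨fun x hx => ?_, h3⟩
  have := H x hx
  rw [gradLin_sub] at this
  linarith

theorem gradLin_eq_fderiv {c : EuclideanSpace ℝ (Fin m)} (hd : DifferentiableAt ℝ h c)
    (v : EuclideanSpace ℝ (Fin m)) : gradLin h c v = fderiv ℝ h c v := by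
  conv_rhs => rw [← (EuclideanSpace.basisFun (Fin m) ℝ).sum_repr v]
  rw [map_sum]
  simp only [map_smul, EuclideanSpace.basisFun_apply, EuclideanSpace.basisFun_repr, smul_eq_mul,
    gradLin, partialD, hd.lineDeriv_eq_fderiv]
  exact Finset.sum_congr rfl fun k _ => mul_comm _ _

theorem slope_le_of_convexOn (hconv : ConvexOn ℝ (orthant m) h) {c x : EuclideanSpace ℝ (Fin m)}
    (hc : c ∈ orthant m) (hx : x ∈ orthant m) {t : ℝ} (ht : 0 < t) (ht1 : t ≤ 1) :
    t⁻¹ * (h (c + t • (x - c)) - h c) ≤ h x - h c := by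
  have h1 := hconv.2 hc hx (sub_nonneg.2 ht1) ht.le (by ring)
  rw [show (1 - t) • c + t • x = c + t • (x - c) by module] at h1
  rw [inv_mul_le_iff₀ ht]
  simp only [smul_eq_mul] at h1
  linarith

theorem tangent_of_differentiableAt (hconv : ConvexOn ℝ (orthant m) h)
    {c : EuclideanSpace ℝ (Fin m)} (hc : c ∈ orthant m) (hd : DifferentiableAt ℝ h c)
    {x : EuclideanSpace ℝ (Fin m)} (hx : x ∈ orthant m) :
    h c + gradLin h c (x - c) ≤ h x := by
  rw [gradLin_eq_fderiv hd]
  have hl : HasDerivAt (fun t : ℝ => h (c + t • (x - c))) (fderiv ℝ h c (x - c)) 0 :=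
    hd.hasFDerivAt.hasLineDerivAt (x - c)
  have ht := hl.tendsto_slope_zero_right
  have hle : fderiv ℝ h c (x - c) ≤ h x - h c := by
    refine le_of_tendsto ht ?_
    filter_upwards [Ioc_mem_nhdsGT (zero_lt_one' ℝ)] with t htm
    simpa using slope_le_of_convexOn hconv hc hx htm.1 htm.2
  linarith

/-- Partial derivatives suffice at an interior point. With `d = x - c`, the vector `-d` is the
average of the `-m dₖ eₖ`, so Jensen bounds `h(c - td)` by values along the axes; midpoint convexity
at `c` turns this into a lower bound for `h(c + td) - h(c)`. Dividing by `t` and letting `t → 0⁺`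
gives the gradient term. -/
theorem tangent_of_hasPartial (hm : 1 ≤ m) (hconv : ConvexOn ℝ (orthant m) h)
    {c : EuclideanSpace ℝ (Fin m)} (hc : c ∈ openOrthant m) (hd : ∀ k, HasPartial h k c)
    {x : EuclideanSpace ℝ (Fin m)} (hx : x ∈ orthant m) :
    h c + gradLin h c (x - c) ≤ h x := by
  have hm0 : (m : ℝ) ≠ 0 := by positivity
  set d := x - c with hddef
  let v : Fin m → EuclideanSpace ℝ (Fin m) := fun k =>
    (-(m : ℝ) * d k) • EuclideanSpace.single k (1 : ℝ)
  have hv : ∑ k, (m : ℝ)⁻¹ • v k = -d := by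
    have h1 := (EuclideanSpace.basisFun (Fin m) ℝ).sum_repr d
    simp only [EuclideanSpace.basisFun_apply, EuclideanSpace.basisFun_repr] at h1
    conv_rhs => rw [← h1]
    rw [← Finset.sum_neg_distrib]
    refine Finset.sum_congr rfl fun k _ => ?_
    rw [smul_smul, ← neg_smul]
    congr 1
    field_simp
  have hder : ∀ k, Tendsto (fun t : ℝ => t⁻¹ * (h (c + t • v k) - h c)) (𝓝[>] 0)
      (𝓝 (-(m : ℝ) * d k * partialD h k c)) := fun k => by
    have h1 : HasDerivAt (fun t : ℝ => h (c + t • v k)) (-(m : ℝ) * d k * partialD h k c) 0 :=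
      (hd k).hasLineDerivAt.smul (-(m : ℝ) * d k)
    simpa using h1.tendsto_slope_zero_right
  have hlim : Tendsto (fun t : ℝ => -((m : ℝ)⁻¹ * ∑ k, t⁻¹ * (h (c + t • v k) - h c))) (𝓝[>] 0)
      (𝓝 (gradLin h c d)) := by
    have h1 := ((tendsto_finsetSum Finset.univ fun k _ => hder k).const_mul (m : ℝ)⁻¹).neg
    convert h1 using 2
    rw [gradLin, Finset.mul_sum, ← Finset.sum_neg_distrib]
    refine Finset.sum_congr rfl fun k _ => ?_
    field_simp
  have hin : ∀ w : EuclideanSpace ℝ (Fin m), ∀ᶠ t : ℝ in 𝓝[>] 0, c + t • w ∈ orthant m := by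
    intro w
    have hcont : Tendsto (fun t : ℝ => c + t • w) (𝓝 0) (𝓝 c) := by
      have : Continuous fun t : ℝ => c + t • w := by fun_prop
      simpa using this.tendsto 0
    filter_upwards [(hcont.mono_left nhdsWithin_le_nhds) (isOpen_openOrthant.mem_nhds hc)] with t ht
    exact openOrthant_subset ht
  have hle : gradLin h c d ≤ h x - h c := by
    refine le_of_tendsto hlim ?_
    filter_upwards [Ioc_mem_nhdsGT (zero_lt_one' ℝ), eventually_all.2 fun k => hin (v k),
      hin (-d), hin d] with t htm hvt hnd hpd
    refine le_trans ?_ (slope_le_of_convexOn hconv (openOrthant_subset hc) hx htm.1 htm.2)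
    have hmid := hconv.2 hnd hpd (show (0 : ℝ) ≤ 1 / 2 by norm_num)
      (show (0 : ℝ) ≤ 1 / 2 by norm_num) (by norm_num)
    rw [show (1 / 2 : ℝ) • (c + t • -d) + (1 / 2 : ℝ) • (c + t • d) = c by module] at hmid
    have hjen := hconv.map_sum_le (t := Finset.univ) (w := fun _ : Fin m => (m : ℝ)⁻¹)
      (p := fun k => c + t • v k) (fun _ _ => by positivity) (by simp [hm0]) (fun k _ => hvt k)
    have hsum : ∑ k, (m : ℝ)⁻¹ • (c + t • v k) = c + t • -d := by
      rw [← hv, Finset.smul_sum]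
      simp only [smul_add, Finset.sum_add_distrib, Finset.sum_const, Finset.card_univ,
        Fintype.card_fin]
      congr 1
      · rw [← Nat.cast_smul_eq_nsmul ℝ, smul_smul, mul_inv_cancel₀ hm0, one_smul]
      · exact Finset.sum_congr rfl fun k _ => smul_comm _ _ _
    rw [hsum] at hjen
    simp only [smul_eq_mul] at hmid hjen
    have hexp : (m : ℝ)⁻¹ * ∑ k, t⁻¹ * (h (c + t • v k) - h c)
        = t⁻¹ * (∑ k, (m : ℝ)⁻¹ * h (c + t • v k) - h c) := by
      rw [← Finset.mul_sum, Finset.sum_sub_distrib, ← Finset.mul_sum]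
      simp only [Finset.sum_const, Finset.card_univ, Fintype.card_fin, nsmul_eq_mul]
      field_simp
    rw [hexp, ← mul_neg]
    exact mul_le_mul_of_nonneg_left (by linarith) (inv_nonneg.2 htm.1.le)
  linarith

/-- A set of support points whose rays are dense in the open orthant approximates `h`. -/
theorem approxBy_of_dense (hh : h ∈ posHom m) {D : Set (EuclideanSpace ℝ (Fin m))}
    (hne : D.Nonempty)
    (hsupp : ∀ c ∈ D, (∀ x ∈ orthant m, gradLin h c x ≤ h x) ∧ gradLin h c c = h c)
    (hdense : ∀ x ∈ openOrthant m, ∀ U : Set (EuclideanSpace ℝ (Fin m)), U ∈ 𝓝 x →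
      ∃ c ∈ D, ∃ t : ℝ, 0 < t ∧ t • c ∈ U) :
    ApproxBy h D := by
  have hcont := hh.1
  -- For `y = t • c` near `x`, applying the minorant at `2y - x` and using equality at `c` gives
  -- `∇h(c) · x ≥ 2h(y) - h(2y - x)`, which tends to `h(x)` as `y → x`.
  have hint : ∀ x ∈ openOrthant m, ∀ ε : ℝ, 0 < ε → ∃ c ∈ D, h x - ε < gradLin h c x := by
    intro x hx ε hε
    have h1 : ∀ᶠ y in 𝓝 x, h x - ε < 2 * h y - h ((2 : ℝ) • y - x) := by
      have hc : Continuous fun y => 2 * h y - h ((2 : ℝ) • y - x) := by fun_prop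
      refine (hc.tendsto x).eventually_const_lt ?_
      rw [show (2 : ℝ) • x - x = x by module]
      linarith
    have h2 : ∀ᶠ y in 𝓝 x, (2 : ℝ) • y - x ∈ openOrthant m := by
      have hc : Continuous fun y => (2 : ℝ) • y - x := by fun_prop
      refine hc.continuousAt.eventually_mem (isOpen_openOrthant.mem_nhds ?_)
      rwa [show (2 : ℝ) • x - x = x by module]
    obtain ⟨c, hc, t, ht, ht1, ht2⟩ := hdense x hx _ (h1.and h2)
    refine ⟨c, hc, ht1.trans_le ?_⟩
    have h3 := (hsupp c hc).1 _ (openOrthant_subset ht2)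
    rw [gradLin_sub, gradLin_smul, gradLin_smul, (hsupp c hc).2] at h3
    rw [hh.2 t ht.le]
    linarith
  -- A boundary point is pushed inside to `x + t • u`; the cost `t * gradLin h c u` is at most `t *
  -- h u`, uniformly in `c`.
  have hall : ∀ x ∈ orthant m, ∀ ε : ℝ, 0 < ε → ∃ c ∈ D, h x - ε < gradLin h c x := by
    intro x hx ε hε
    let u : EuclideanSpace ℝ (Fin m) := WithLp.toLp 2 fun _ => 1
    have hu : u ∈ openOrthant m := fun k => one_pos
    have h1 : ∀ᶠ t : ℝ in 𝓝[>] 0, h x - ε / 2 < h (x + t • u) - t * h u := by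
      have hc : Continuous fun t : ℝ => h (x + t • u) - t * h u := by fun_prop
      refine ((hc.tendsto 0).mono_left nhdsWithin_le_nhds).eventually_const_lt ?_
      simp only [zero_smul, add_zero, zero_mul, sub_zero]
      linarith
    obtain ⟨t, ht1, ht⟩ := (h1.and self_mem_nhdsWithin).exists
    have ht0 : 0 < t := ht
    obtain ⟨c, hc, hlt⟩ := hint (x + t • u)
      (fun k => add_pos_of_nonneg_of_pos (hx k) (mul_pos ht0 (hu k))) (ε / 2) (by positivity)
    refine ⟨c, hc, ?_⟩
    rw [gradLin_add, gradLin_smul] at hlt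
    have := mul_le_mul_of_nonneg_left ((hsupp c hc).1 u (openOrthant_subset hu)) ht0.le
    linarith
  refine ⟨fun c hc => (hsupp c hc).1, fun ε hε => ?_⟩
  have hclosed : IsClosed (orthant m) := by
    have : orthant m = ⋂ k : Fin m, {x | 0 ≤ x k} := by ext; simp [orthant]
    rw [this]
    exact isClosed_iInter fun k => isClosed_le continuous_const (by fun_prop)
  have hK : IsCompact (Metric.sphere (0 : EuclideanSpace ℝ (Fin m)) 1 ∩ orthant m) :=
    (isCompact_sphere 0 1).inter_right hclosed
  obtain ⟨F, hF⟩ := hK.elim_finite_subcover (fun c : D => {x | h x - ε < gradLin h c x})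
    (fun c => isOpen_lt (by fun_prop) (continuous_gradLin h c)) (fun x hx => by
      obtain ⟨c, hc, hlt⟩ := hall x hx.2 ε hε
      exact Set.mem_iUnion.2 ⟨⟨c, hc⟩, hlt⟩)
  obtain ⟨c₀, hc₀⟩ := hne
  classical
  -- `c₀` serves `x = 0`, which cannot be scaled to the sphere.
  refine ⟨insert c₀ (F.image Subtype.val), ?_, fun x hx => ?_⟩
  · intro c hc
    rcases Finset.mem_insert.1 hc with rfl | hc
    · exact hc₀
    · obtain ⟨d, -, rfl⟩ := Finset.mem_image.1 hc
      exact d.2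
  · by_cases hx0 : x = 0
    · exact ⟨c₀, Finset.mem_insert_self _ _, by simp [hx0, posHom_zero hh, gradLin]⟩
    · have hn : 0 < ‖x‖ := norm_pos_iff.2 hx0
      have hxK : ‖x‖⁻¹ • x ∈ Metric.sphere (0 : EuclideanSpace ℝ (Fin m)) 1 ∩ orthant m := by
        refine ⟨?_, smul_mem_orthant (by positivity) hx⟩
        rw [mem_sphere_zero_iff_norm, norm_smul, norm_inv, norm_norm, inv_mul_cancel₀ hn.ne']
      obtain ⟨c, hcF, hlt⟩ := Set.mem_iUnion₂.1 (hF hxK)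
      refine ⟨c, Finset.mem_insert_of_mem (Finset.mem_image_of_mem _ hcF), ?_⟩
      have hlt' : h (‖x‖⁻¹ • x) - ε < gradLin h c (‖x‖⁻¹ • x) := hlt
      rw [hh.2 _ (by positivity), gradLin_smul] at hlt'
      have h1 := mul_lt_mul_of_pos_left hlt' hn
      rw [mul_sub, mul_inv_cancel_left₀ hn.ne', mul_inv_cancel_left₀ hn.ne'] at h1
      -- Rescaling from the sphere gives an error `ε * ‖x‖`; on the orthant the sum of coordinates
      -- dominates the norm.
      have h2 : ‖x‖ ≤ ∑ k, x k := by
        have h3 : 0 ≤ ∑ k, x k := Finset.sum_nonneg fun k _ => hx k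
        rw [EuclideanSpace.norm_eq]
        refine (Real.sqrt_le_left h3).2 ?_
        simp only [Real.norm_eq_abs, sq_abs]
        exact Finset.sum_sq_le_sq_sum_of_nonneg fun k _ => hx k
      have := mul_le_mul_of_nonneg_left h2 hε.le
      linarith

theorem differentiableAt_smul_of_posHom (hh : h ∈ posHom m) {y : EuclideanSpace ℝ (Fin m)}
    (hd : DifferentiableAt ℝ h y) {t : ℝ} (ht : 0 < t) : DifferentiableAt ℝ h (t • y) := by
  have heq : h = fun z => t * h (t⁻¹ • z) := by
    ext z
    rw [hh.2 _ (by positivity), mul_inv_cancel_left₀ ht.ne']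
  rw [heq]
  have : DifferentiableAt ℝ h (t⁻¹ • (t • y)) := by
    rwa [smul_smul, inv_mul_cancel₀ ht.ne', one_smul]
  exact (this.comp (t • y) (differentiableAt_id.const_smul t⁻¹)).const_mul t

/-- A convex function is locally Lipschitz on the open orthant, hence differentiable almost
everywhere there by Rademacher's theorem, and nonempty open sets have positive measure. -/
theorem exists_differentiableAt_mem (hconv : ConvexOn ℝ (orthant m) h)
    {x : EuclideanSpace ℝ (Fin m)} (hx : x ∈ openOrthant m) {U : Set (EuclideanSpace ℝ (Fin m))}
    (hU : U ∈ 𝓝 x) : ∃ y ∈ U, y ∈ openOrthant m ∧ DifferentiableAt ℝ h y := by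
  obtain ⟨K, s, hs, hlip⟩ := (hconv.subset openOrthant_subset convex_openOrthant).locallyLipschitzOn
    isOpen_openOrthant hx
  rw [isOpen_openOrthant.nhdsWithin_eq hx] at hs
  obtain ⟨W, hWsub, hWo, hxW⟩ := mem_nhds_iff.1
    (inter_mem (inter_mem hs hU) (isOpen_openOrthant.mem_nhds hx))
  have hae := (hlip.mono fun y hy => (hWsub hy).1.1).ae_differentiableWithinAt_of_mem
    (μ := (MeasureTheory.volume : MeasureTheory.Measure (EuclideanSpace ℝ (Fin m)))) (s := W)
  have hpos : MeasureTheory.volume W ≠ 0 := (hWo.measure_pos _ ⟨x, hxW⟩).ne'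
  obtain ⟨y, hyW, hy⟩ : ∃ y ∈ W, DifferentiableWithinAt ℝ h W y := by
    by_contra! hcon
    apply hpos
    refine MeasureTheory.measure_mono_null (fun y hy => ?_) hae
    exact fun hcontra => hcon y hy (hcontra hy)
  exact ⟨y, (hWsub hyW).1.2, (hWsub hyW).2, hy.differentiableAt (hWo.mem_nhds hyW)⟩

theorem ne_zero_of_mem_openOrthant (hm : 1 ≤ m) {y : EuclideanSpace ℝ (Fin m)}
    (hy : y ∈ openOrthant m) : y ≠ 0 := by
  rintro rfl
  exact lt_irrefl _ (hy ⟨0, hm⟩)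

theorem approxBy_diffUnit (hm : 1 ≤ m) (hh : h ∈ posHom m) (hconv : ConvexOn ℝ (orthant m) h) :
    ApproxBy h (diffUnit h) := by
  have hdense : ∀ x ∈ openOrthant m, ∀ U : Set (EuclideanSpace ℝ (Fin m)), U ∈ 𝓝 x →
      ∃ c ∈ diffUnit h, ∃ t : ℝ, 0 < t ∧ t • c ∈ U := by
    intro x hx U hU
    obtain ⟨y, hyU, hy, hd⟩ := exists_differentiableAt_mem hconv hx hU
    have hn : 0 < ‖y‖ := norm_pos_iff.2 (ne_zero_of_mem_openOrthant hm hy)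
    refine ⟨‖y‖⁻¹ • y, ⟨smul_mem_orthant (by positivity) (openOrthant_subset hy),
      differentiableAt_smul_of_posHom hh hd (by positivity), ?_⟩, ‖y‖, hn, ?_⟩
    · rw [norm_smul, norm_inv, norm_norm, inv_mul_cancel₀ hn.ne']
    · rwa [smul_smul, mul_inv_cancel₀ hn.ne', one_smul]
  refine approxBy_of_dense hh ?_ (fun c hc => gradLin_support_of_tangent hh hc.1 fun x hx =>
    tangent_of_differentiableAt hconv hc.1 hc.2.1 hx) hdense
  obtain ⟨c, hc, -⟩ := hdense (WithLp.toLp 2 fun _ => 1) (fun k => one_pos) _ univ_mem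
  exact ⟨c, hc⟩

end Support

/-! ### Spherical coordinates and the dyadic grids. -/

section Spherical

variable {m : ℕ}

theorem sph_apply (θ : Fin (m - 1) → ℝ) (k : Fin m) :
    sph θ k = (∏ j : Fin (m - 1) with j.val < k.val, Real.sin (θ j)) *
      if hk : k.val < m - 1 then Real.cos (θ ⟨k.val, hk⟩) else 1 := rfl

theorem continuous_sph : Continuous (sph : (Fin (m - 1) → ℝ) → EuclideanSpace ℝ (Fin m)) := by
  refine (PiLp.continuous_toLp 2 _).comp (continuous_pi fun k => ?_)
  refine Continuous.mul (by fun_prop) ?_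
  split_ifs with hk
  · fun_prop
  · fun_prop

theorem sph_mem_orthant {θ : Fin (m - 1) → ℝ} (hθ : ∀ j, θ j ∈ Set.Icc 0 (Real.pi / 2)) :
    sph θ ∈ orthant m := by
  have hpi := Real.pi_pos
  intro k
  rw [sph_apply]
  refine mul_nonneg (Finset.prod_nonneg fun j _ =>
    Real.sin_nonneg_of_mem_Icc ⟨(hθ j).1, by linarith [(hθ j).2]⟩) ?_
  split_ifs with hk
  · exact Real.cos_nonneg_of_mem_Icc ⟨by linarith [(hθ ⟨k, hk⟩).1], (hθ ⟨k, hk⟩).2⟩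
  · exact zero_le_one

theorem sph_mem_openOrthant {θ : Fin (m - 1) → ℝ} (hθ : ∀ j, θ j ∈ Set.Ioo 0 (Real.pi / 2)) :
    sph θ ∈ openOrthant m := by
  have hpi := Real.pi_pos
  intro k
  rw [sph_apply]
  refine mul_pos (Finset.prod_pos fun j _ =>
    Real.sin_pos_of_mem_Ioo ⟨(hθ j).1, by linarith [(hθ j).2]⟩) ?_
  split_ifs with hk
  · exact Real.cos_pos_of_mem_Ioo ⟨by linarith [(hθ ⟨k, hk⟩).1], (hθ ⟨k, hk⟩).2⟩
  · exact zero_lt_one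

/-- Every unit vector of the closed orthant has spherical coordinates in `[0, π/2]`. -/
theorem exists_sph_eq (hm : 1 ≤ m) {x : EuclideanSpace ℝ (Fin m)} (hx : x ∈ orthant m)
    (hx1 : ‖x‖ = 1) :
    ∃ θ : Fin (m - 1) → ℝ, (∀ j, θ j ∈ Set.Icc 0 (Real.pi / 2)) ∧ sph θ = x := by
  -- `R i` is the norm of the tail of `x` from index `i` on. The angles `arccos (x j / R j)` make
  -- the products of sines telescope to `R i`. If `R j = 0`, the quotient is `0` by convention,
  -- which is harmless since then `x j = 0`.
  let R : ℕ → ℝ := fun i => √(∑ k : Fin m with i ≤ k.val, x k ^ 2)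
  have hR0 : ∀ i, 0 ≤ R i := fun i => Real.sqrt_nonneg _
  have hRsq : ∀ i, R i ^ 2 = ∑ k : Fin m with i ≤ k.val, x k ^ 2 := fun i =>
    Real.sq_sqrt (Finset.sum_nonneg fun k _ => sq_nonneg _)
  have hstep : ∀ k : Fin m, R k ^ 2 = x k ^ 2 + R (k + 1) ^ 2 := by
    intro k
    have hset : (Finset.univ.filter fun i : Fin m => k.val ≤ i.val)
        = insert k (Finset.univ.filter fun i : Fin m => k.val + 1 ≤ i.val) := by
      ext i
      simp only [Finset.mem_filter, Finset.mem_univ, true_and, Finset.mem_insert, Fin.ext_iff]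
      omega
    rw [hRsq, hRsq, hset, Finset.sum_insert (by simp)]
  have hquot : ∀ k : Fin m, x k / R k ∈ Set.Icc (0 : ℝ) 1 := by
    intro k
    refine ⟨div_nonneg (hx k) (hR0 k), div_le_one_of_le₀ ?_ (hR0 k)⟩
    refine abs_le_of_sq_le_sq' ?_ (hR0 k) |>.2
    nlinarith [hstep k, sq_nonneg (R (k + 1))]
  have hcos : ∀ k : Fin m, R k * (x k / R k) = x k := by
    intro k
    rcases eq_or_ne (R k) 0 with h0 | h0
    · have h1 := hstep k
      rw [h0] at h1 ⊢
      have : x k = 0 := by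
        nlinarith [sq_nonneg (x k), sq_nonneg (R (k + 1))]
      simp [this]
    · field_simp
  have hsin : ∀ k : Fin m, R k * √(1 - (x k / R k) ^ 2) = R (k + 1) := by
    intro k
    rw [← Real.sqrt_sq (hR0 k), ← Real.sqrt_mul (sq_nonneg _), ← Real.sqrt_sq (hR0 (k + 1)),
      Real.sqrt_sq (hR0 k)]
    congr 1
    have h1 := hcos k
    have h2 : R k ^ 2 * (1 - (x k / R k) ^ 2) = R k ^ 2 - (R k * (x k / R k)) ^ 2 := by ring
    rw [h2, h1, hstep k]
    ring
  let ι : Fin (m - 1) → Fin m := fun j => ⟨j, by omega⟩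
  let θ : Fin (m - 1) → ℝ := fun j => Real.arccos (x (ι j) / R j)
  have hprod : ∀ i : ℕ, i ≤ m - 1 →
      ∏ j : Fin (m - 1) with j.val < i, Real.sin (θ j) = R i := by
    intro i
    induction i with
    | zero =>
      intro _
      have : R 0 = 1 := by
        rw [← hx1, EuclideanSpace.norm_eq]
        simp [R]
      simp [this]
    | succ i ih =>
      intro hi
      have hset : (Finset.univ.filter fun j : Fin (m - 1) => j.val < i + 1)
          = insert ⟨i, hi⟩ (Finset.univ.filter fun j : Fin (m - 1) => j.val < i) := by
        ext j
        simp only [Finset.mem_filter, Finset.mem_univ, true_and, Finset.mem_insert, Fin.ext_iff]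
        omega
      rw [hset, Finset.prod_insert (by simp), ih (by omega), Real.sin_arccos, mul_comm]
      exact hsin (ι ⟨i, hi⟩)
  refine ⟨θ, fun j => ⟨Real.arccos_nonneg _, ?_⟩, ?_⟩
  · rw [Real.arccos_le_pi_div_two]
    exact (hquot (ι j)).1
  · ext k
    rw [sph_apply, hprod k (by omega)]
    split_ifs with hk
    · have h1 := hquot k
      have h2 : Real.cos (θ ⟨k, hk⟩) = x k / R k :=
        Real.cos_arccos (by linarith [h1.1]) h1.2
      rw [h2, hcos k]
    -- For the last index the tail has a single coordinate, so `R k = x k`.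
    · rw [mul_one]
      have h1 := hstep k
      have h2 : R (k + 1) ^ 2 = 0 := by
        rw [hRsq]
        refine Finset.sum_eq_zero fun i hi => ?_
        have := (Finset.mem_filter.1 hi).2
        omega
      rw [h2, add_zero] at h1
      exact (sq_eq_sq₀ (hR0 k) (hx k)).1 h1

theorem mem_grid {n : ℕ} {θ : Fin (m - 1) → ℝ} :
    θ ∈ grid m n ↔ ∃ l : Fin (m - 1) → ℕ, (∀ j, 1 ≤ l j ∧ l j ≤ 2 ^ n) ∧
      ∀ j, θ j = l j * Real.pi / 2 ^ (n + 1) := by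
  simp only [grid, Finset.mem_image, Fintype.mem_piFinset, Finset.mem_Icc]
  constructor
  · rintro ⟨l, hl, rfl⟩
    exact ⟨l, hl, fun _ => rfl⟩
  · rintro ⟨l, hl, h⟩
    exact ⟨l, hl, (funext h).symm⟩

theorem grid_subset_succ (n : ℕ) : grid m n ⊆ grid m (n + 1) := by
  intro θ hθ
  obtain ⟨l, hl, h⟩ := mem_grid.1 hθ
  refine mem_grid.2 ⟨fun j => 2 * l j, fun j => ?_, fun j => ?_⟩
  · have := hl j
    show 1 ≤ 2 * l j ∧ 2 * l j ≤ 2 ^ (n + 1)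
    rw [pow_succ]
    omega
  · rw [h j]
    push_cast
    field_simp
    ring

theorem grid_mono : Monotone (grid m) := monotone_nat_of_le_succ grid_subset_succ

theorem grid_mem_Icc {n : ℕ} {θ : Fin (m - 1) → ℝ} (hθ : θ ∈ grid m n) (j : Fin (m - 1)) :
    θ j ∈ Set.Icc 0 (Real.pi / 2) := by
  have hpi := Real.pi_pos
  obtain ⟨l, hl, h⟩ := mem_grid.1 hθ
  rw [h j]
  refine ⟨by positivity, ?_⟩
  have h1 : (l j : ℝ) ≤ 2 ^ n := by exact_mod_cast (hl j).2
  rw [div_le_div_iff₀ (by positivity) two_pos, pow_succ]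
  nlinarith

theorem gridPoints_subset_orthant : gridPoints m ⊆ orthant m := by
  rintro _ ⟨n, -, θ, hθ, rfl⟩
  exact sph_mem_orthant (grid_mem_Icc hθ)

/-- The strict bound `l < 2 ^ n` keeps the angle below `π/2`, so that the nearby grid point is
interior. Hence the choice of `⌈s⌉₊ - 1`, still within `1` of `s`, or of `1` when that would be
zero. -/
theorem exists_dyadic_near {n : ℕ} (hn : 1 ≤ n) {t : ℝ} (ht : t ∈ Set.Icc 0 (Real.pi / 2)) :
    ∃ l : ℕ, 1 ≤ l ∧ l < 2 ^ n ∧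
      |(l : ℝ) * Real.pi / 2 ^ (n + 1) - t| ≤ Real.pi / 2 ^ (n + 1) := by
  have hpi := Real.pi_pos
  set q : ℝ := 2 ^ (n + 1) with hq
  have hq0 : 0 < q := by positivity
  set s : ℝ := t * q / Real.pi with hs
  have hts : t = s * Real.pi / q := by rw [hs]; field_simp
  have hs0 : 0 ≤ s := by have := ht.1; positivity
  have hs1 : s ≤ 2 ^ n := by
    rw [hs, div_le_iff₀ hpi, hq, pow_succ]
    have : (0 : ℝ) < 2 ^ n := by positivity
    nlinarith [ht.2]
  have hceil : ⌈s⌉₊ ≤ 2 ^ n := Nat.ceil_le.2 (by exact_mod_cast hs1)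
  have h2n : 2 ≤ 2 ^ n := by
    calc 2 = 2 ^ 1 := by norm_num
      _ ≤ 2 ^ n := Nat.pow_le_pow_right (by norm_num) hn
  have key : ∀ l : ℕ, |(l : ℝ) - s| ≤ 1 → |(l : ℝ) * Real.pi / q - t| ≤ Real.pi / q := by
    intro l hl
    rw [hts, show (l : ℝ) * Real.pi / q - s * Real.pi / q = (l - s) * (Real.pi / q) by ring, abs_mul,
      abs_of_pos (show 0 < Real.pi / q by positivity)]
    exact mul_le_of_le_one_left (by positivity) hl
  by_cases h2 : 2 ≤ ⌈s⌉₊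
  · refine ⟨⌈s⌉₊ - 1, by omega, by omega, key _ ?_⟩
    have h3 := Nat.le_ceil s
    have h4 := Nat.ceil_lt_add_one hs0
    rw [Nat.cast_sub (by omega), Nat.cast_one, abs_le]
    constructor <;> linarith
  · refine ⟨1, le_rfl, by omega, key _ ?_⟩
    have h3 : s ≤ 1 := by
      refine (Nat.le_ceil s).trans ?_
      exact_mod_cast (show ⌈s⌉₊ ≤ 1 by omega)
    rw [Nat.cast_one, abs_le]
    constructor <;> linarith

theorem exists_grid_near {θ : Fin (m - 1) → ℝ} (hθ : ∀ j, θ j ∈ Set.Icc 0 (Real.pi / 2))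
    {ε : ℝ} (hε : 0 < ε) :
    ∃ n : ℕ, 1 ≤ n ∧ ∃ θ' ∈ grid m n, (∀ j, θ' j ∈ Set.Ioo 0 (Real.pi / 2)) ∧ dist θ' θ < ε := by
  have hpi := Real.pi_pos
  obtain ⟨n, hn⟩ := exists_nat_gt (Real.pi / ε)
  have hn1 : 1 ≤ n := by
    have : (0 : ℝ) < n := lt_trans (by positivity) hn
    exact_mod_cast this
  have hsmall : Real.pi / 2 ^ (n + 1) < ε := by
    rw [div_lt_iff₀ (by positivity)]
    rw [div_lt_iff₀ hε] at hn
    have h1 : (n : ℝ) < 2 ^ (n + 1) := by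
      exact_mod_cast (Nat.lt_two_pow_self (n := n)).trans (Nat.pow_lt_pow_succ (by norm_num))
    nlinarith
  choose l hl1 hl2 hl3 using fun j => exists_dyadic_near hn1 (hθ j)
  refine ⟨n, hn1, fun j => l j * Real.pi / 2 ^ (n + 1),
    mem_grid.2 ⟨l, fun j => ⟨hl1 j, (hl2 j).le⟩, fun _ => rfl⟩, fun j => ⟨?_, ?_⟩, ?_⟩
  · have : (0 : ℝ) < l j := by exact_mod_cast hl1 j
    positivity
  · have h1 : (l j : ℝ) < 2 ^ n := by exact_mod_cast hl2 j
    rw [div_lt_div_iff₀ (by positivity) two_pos, pow_succ]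
    nlinarith
  · rw [dist_pi_lt_iff hε]
    exact fun j => (hl3 j).trans_lt hsmall

theorem sph_mem_closure {θ : Fin (m - 1) → ℝ} (hθ : ∀ j, θ j ∈ Set.Icc 0 (Real.pi / 2)) :
    sph θ ∈ closure (gridPoints m ∩ openOrthant m) := by
  rw [mem_closure_iff_nhds]
  intro U hU
  obtain ⟨ε, hε, hball⟩ := Metric.mem_nhds_iff.1 (continuous_sph.continuousAt hU)
  obtain ⟨n, hn, θ', hθ', hpos, hd⟩ := exists_grid_near hθ hε
  exact ⟨sph θ', hball hd, ⟨n, hn, θ', hθ', rfl⟩, sph_mem_openOrthant hpos⟩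

/-- A grid point with an angle `π/2` lies on the boundary, where the interior tangent argument is
unavailable. It is a limit of interior grid points, and the tangent inequality passes to the limit
because the partial derivatives are continuous on `gridPoints m`. -/
theorem gridPoints_support (hm : 1 ≤ m) {h : EuclideanSpace ℝ (Fin m) → ℝ} (hh : h ∈ posHom m)
    (hconv : ConvexOn ℝ (orthant m) h) (hu : UnifContPartials h) {c : EuclideanSpace ℝ (Fin m)}
    (hc : c ∈ gridPoints m) :
    (∀ x ∈ orthant m, gradLin h c x ≤ h x) ∧ gradLin h c c = h c := by
  refine gradLin_support_of_tangent hh (gridPoints_subset_orthant hc) fun x hx => ?_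
  have hcl : c ∈ closure (gridPoints m ∩ openOrthant m) := by
    obtain ⟨n, -, θ, hθ, rfl⟩ := hc
    exact sph_mem_closure (grid_mem_Icc hθ)
  have := mem_closure_iff_nhdsWithin_neBot.1 hcl
  have hlim : Tendsto (fun y => h y + gradLin h y (x - y)) (𝓝[gridPoints m ∩ openOrthant m] c)
      (𝓝 (h c + gradLin h c (x - c))) := by
    refine Tendsto.add ((hh.1.tendsto c).mono_left nhdsWithin_le_nhds) ?_
    refine tendsto_finsetSum _ fun k _ => Tendsto.mul ?_ ?_
    · exact ((hu k).2.continuousOn c hc).mono_left (nhdsWithin_mono _ Set.inter_subset_left)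
    · have : Continuous fun y : EuclideanSpace ℝ (Fin m) => (x - y) k := by fun_prop
      exact (this.tendsto c).mono_left nhdsWithin_le_nhds
  refine le_of_tendsto hlim ?_
  filter_upwards [self_mem_nhdsWithin] with y hy
  exact tangent_of_hasPartial hm hconv hy.2 (fun k => (hu k).1 y hy.1) hx

theorem approxBy_gridPoints (hm : 1 ≤ m) {h : EuclideanSpace ℝ (Fin m) → ℝ} (hh : h ∈ posHom m)
    (hconv : ConvexOn ℝ (orthant m) h) (hu : UnifContPartials h) :
    ApproxBy h (gridPoints m) := by
  refine approxBy_of_dense hh ?_ (fun c hc => gridPoints_support hm hh hconv hu hc) ?_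
  · obtain ⟨θ, hθ⟩ := grid_nonempty m 1
    exact ⟨sph θ, 1, le_rfl, θ, hθ, rfl⟩
  · intro x hx U hU
    have hn : 0 < ‖x‖ := norm_pos_iff.2 (ne_zero_of_mem_openOrthant hm hx)
    obtain ⟨θ, hθ, hθx⟩ := exists_sph_eq hm
      (smul_mem_orthant (inv_nonneg.2 hn.le) (openOrthant_subset hx))
      (by rw [norm_smul, norm_inv, norm_norm, inv_mul_cancel₀ hn.ne'])
    have hcl := sph_mem_closure hθ
    rw [hθx] at hcl
    have hcont : Continuous fun y : EuclideanSpace ℝ (Fin m) => ‖x‖ • y := by fun_prop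
    have hpre : (fun y : EuclideanSpace ℝ (Fin m) => ‖x‖ • y) ⁻¹' U ∈ 𝓝 (‖x‖⁻¹ • x) := by
      refine hcont.continuousAt ?_
      rwa [smul_smul, mul_inv_cancel₀ hn.ne', one_smul]
    obtain ⟨c, hcU, hc, -⟩ := mem_closure_iff_nhds.1 hcl _ hpre
    exact ⟨c, hc, ‖x‖, hn, hcU⟩

/-- The finitely many approximating points all lie in one grid, and the grids increase with `n`. -/
theorem exists_grid_approx {h : EuclideanSpace ℝ (Fin m) → ℝ} (hD : ApproxBy h (gridPoints m))
    {ε : ℝ} (hε : 0 < ε) :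
    ∃ N : ℕ, ∀ n ≥ N, ∀ x ∈ orthant m,
      ∃ θ ∈ grid m n, h x ≤ gradLin h (sph θ) x + ε * ∑ k, x k := by
  obtain ⟨F, hF, happ⟩ := hD.2 ε hε
  have hF' : ∀ c ∈ F, ∃ n : ℕ, ∃ θ ∈ grid m n, c = sph θ := fun c hc => by
    obtain ⟨n, -, θ, hθ⟩ := hF hc
    exact ⟨n, θ, hθ⟩
  choose! ν θ hθ hsph using hF'
  refine ⟨F.sup ν, fun n hn x hx => ?_⟩
  obtain ⟨c, hc, hle⟩ := happ x hx
  refine ⟨θ c, grid_mono ((Finset.le_sup hc).trans hn) (hθ c hc), ?_⟩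
  rwa [← hsph c hc]

end Spherical

/-! ### Reduction of the concave case to the convex one. -/

section Negation

variable {m : ℕ} {E : Type*} [AddCommGroup E] [Lattice E] [Module ℝ E]

theorem neg_mem_posHom {h : EuclideanSpace ℝ (Fin m) → ℝ} (hh : h ∈ posHom m) : -h ∈ posHom m :=
  ⟨hh.1.neg, fun t ht x => by simp [hh.2 t ht x]⟩

theorem partialD_neg (h : EuclideanSpace ℝ (Fin m) → ℝ) (k : Fin m)
    (c : EuclideanSpace ℝ (Fin m)) : partialD (-h) k c = -partialD h k c :=
  deriv.fun_neg

theorem gradDot_neg {F : Type*} [AddCommGroup F] [Module ℝ F] (h : EuclideanSpace ℝ (Fin m) → ℝ)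
    (c : EuclideanSpace ℝ (Fin m)) (a : Fin m → F) : gradDot (-h) c a = -gradDot h c a := by
  simp [gradDot, partialD_neg]

theorem diffUnit_neg (h : EuclideanSpace ℝ (Fin m) → ℝ) : diffUnit (-h) = diffUnit h := by
  ext c
  simp [diffUnit, differentiableAt_neg_iff]

theorem unifContPartials_neg {h : EuclideanSpace ℝ (Fin m) → ℝ} (hu : UnifContPartials h) :
    UnifContPartials (-h) := by
  intro k
  refine ⟨fun c hc => ((hu k).1 c hc).neg, ?_⟩
  have : partialD (-h) k = fun c => -partialD h k c := funext fun c => partialD_neg h k c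
  rw [this]
  exact uniformContinuous_neg.comp_uniformContinuousOn (hu k).2

theorem latticeSpan_insert_neg (b : E) (A : Set E) :
    latticeSpan (insert (-b) A) = latticeSpan (insert b A) := by
  have key : ∀ b : E, latticeSpan (insert (-b) A) ≤ latticeSpan (insert b A) := fun b =>
    latticeSpan_le (isVectorSublattice_latticeSpan _) <| Set.insert_subset
      (Submodule.neg_mem _ (subset_latticeSpan _ (Set.mem_insert b A)))
      ((Set.subset_insert b A).trans (subset_latticeSpan _))
  refine le_antisymm (key b) ?_
  simpa using key (-b)

theorem calcEq_neg {h : EuclideanSpace ℝ (Fin m) → ℝ} (hh : h ∈ posHom m) (a : Fin m → E) (b : E) :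
    CalcEq (-h) a (-b) ↔ CalcEq h a b := by
  rw [calcEq_iff hh, calcEq_iff (neg_mem_posHom hh), latticeSpan_insert_neg]
  simp

variable [IsOrderedAddMonoid E]

theorem gridSup_neg (h : EuclideanSpace ℝ (Fin m) → ℝ) (a : Fin m → E) (n : ℕ) :
    gridSup (-h) a n = -gridInf h a n := by
  unfold gridSup gridInf
  simp only [gradDot_neg]
  apply le_antisymm
  · exact Finset.sup'_le _ _ fun θ hθ => neg_le_neg (Finset.inf'_le _ hθ)
  · refine neg_le.1 (Finset.le_inf' _ _ fun θ hθ => neg_le.1 ?_)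
    exact Finset.le_sup' (fun θ => -gradDot h (sph θ) a) hθ

theorem RUConverges.neg {F : Type*} [AddCommGroup F] [Lattice F] [Module ℝ F] {f : ℕ → F} {g : F}
    (H : RUConverges f g) :
    RUConverges (fun n => -f n) (-g) := by
  obtain ⟨p, hp, H⟩ := H
  refine ⟨p, hp, fun ε hε => ?_⟩
  obtain ⟨N, hN⟩ := H ε hε
  refine ⟨N, fun n hn => ?_⟩
  rw [← neg_add', abs_neg, ← sub_eq_add_neg]
  exact hN n hn

end Negation

end VL

theorem theorem3p8 {E : Type*} [AddCommGroup E] [Lattice E] [IsOrderedAddMonoid E]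
    [Module ℝ E] [IsOrderedModule ℝ E] (hE : VL.IsArchimedean E)
    {m : ℕ} (hm : 1 ≤ m) (h : EuclideanSpace ℝ (Fin m) → ℝ) (hh : h ∈ VL.posHom m)
    (a : Fin m → E) (ha : ∀ k, 0 ≤ a k) :
    -- part (1), convex and concave
    (ConvexOn ℝ (VL.orthant m) h →
      ∀ b : E, VL.CalcEq h a b ↔ IsLUB {x | ∃ c ∈ VL.diffUnit h, x = VL.gradDot h c a} b) ∧
    (ConcaveOn ℝ (VL.orthant m) h →
      ∀ b : E, VL.CalcEq h a b ↔ IsGLB {x | ∃ c ∈ VL.diffUnit h, x = VL.gradDot h c a} b) ∧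
    -- part (2), convex and concave
    (2 ≤ m → Nontrivial E → VL.UnifContPartials h →
      (ConvexOn ℝ (VL.orthant m) h →
        ∀ b : E, VL.CalcEq h a b → VL.RUConverges (VL.gridSup h a) b) ∧
      (ConcaveOn ℝ (VL.orthant m) h →
        ∀ b : E, VL.CalcEq h a b → VL.RUConverges (VL.gridInf h a) b)) := by
  -- Stated for a general `g` because it is applied to both `h` and `-h`.
  have hsup : ∀ g ∈ VL.posHom m, VL.UnifContPartials g → ConvexOn ℝ (VL.orthant m) g →
      Nontrivial E → ∀ b : E, VL.CalcEq g a b → VL.RUConverges (VL.gridSup g a) b := by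
    intro g hg hu hconv _ b hb
    have hD := VL.approxBy_gridPoints hm hg hconv hu
    exact VL.ruConverges_gridSup hE hg ha hD.1 (fun ε hε => VL.exists_grid_approx hD hε) hb
  refine ⟨fun hconv b => VL.calcEq_iff_isLUB hE hh ha (VL.approxBy_diffUnit hm hh hconv) b,
    fun hconc b => ?_, fun _ hnt hu => ⟨fun hconv b hb => hsup h hh hu hconv hnt b hb,
      fun hconc b hb => ?_⟩⟩
  · rw [← VL.calcEq_neg hh, VL.calcEq_iff_isLUB hE (VL.neg_mem_posHom hh) ha
      (VL.approxBy_diffUnit hm (VL.neg_mem_posHom hh) hconc.neg), VL.diffUnit_neg]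
    have : {x | ∃ c ∈ VL.diffUnit h, x = VL.gradDot (-h) c a}
        = -{x | ∃ c ∈ VL.diffUnit h, x = VL.gradDot h c a} := by
      ext x
      simp [VL.gradDot_neg, neg_eq_iff_eq_neg]
    rw [this, isLUB_neg, neg_neg]
  · have H := (hsup (-h) (VL.neg_mem_posHom hh) (VL.unifContPartials_neg hu) hconc.neg hnt (-b)
      ((VL.calcEq_neg hh a b).2 hb)).neg
    simpa [VL.gridSup_neg] using H
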